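/- Let $n\ge 1$ and let $F=\mathbb{C}(\varepsilon_1,\dots,\varepsilon_{n+3},q_1,\dots,q_n,p_1,\dots,p_n,x_1,\dots,x_n)$ be the field of rational functions in $4n+3$ independent variables, with the Poisson bracket $$\{\varphi,\psi\}=\sum_{j=1}^n\Bigl(\frac{\partial\varphi}{\partial p_j}\frac{\partial\psi}{\partial q_j}-\frac{\partial\varphi}{\partial q_j}\frac{\partial\psi}{\partial p_j}\Bigr).$$ Put $Q_1=\sum_{l=1}^n q_lp_l+\tfrac12\bigl(1-\sum_{l=1}^{n+3}\varepsilon_l\bigr)$, $Q_2=\sum_{j=1}^n q_j-1$, and let $\sigma_k$ denote the transposition $(k,k+1)$. Then there are unique $\mathbb{C}$-automorphisms $s_0,\dots,s_{n+3}$ of the field $F$ (birational transformations) such that, for all $i$ and $j$: * $s_0(\varepsilon_1)=1-\varepsilon_2$, $s_0(\varepsilon_2)=1-\varepsilon_1$, $s_0(\varepsilon_j)=\varepsilon_j$ $(j\ne1,2)$; $s_k(\varepsilon_j)=\varepsilon_{\sigma_k(j)}$ $(1\le k\le n+2)$; $s_{n+3}(\varepsilon_j)=(-1)^{\delta_{j,n+3}}\varepsilon_j$;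 * $s_0(q_j)=\dfrac{p_j(q_jp_j-\varepsilon_{j+3})}{Q_1(Q_1+\varepsilon_3)}$, $s_0(q_jp_j)=\varepsilon_{j+3}-q_jp_j$, $s_0(x_i)=1/x_i$; * $s_1(q_j)=q_j/x_j$, $s_1(p_j)=x_jp_j$, $s_1(x_i)=1/x_i$; * $s_2(q_j)=q_j/Q_2$, $s_2(p_j)=(p_j-Q_1)Q_2$, $s_2(x_i)=x_i/(x_i-1)$; * $s_3(q_1)=1/q_1$, $s_3(p_1)=-q_1Q_1$, $s_3(x_1)=1/x_1$, and $s_3(q_j)=-q_j/q_1$, $s_3(p_j)=-q_1p_j$, $s_3(x_j)=x_j/x_1$ for $j\ne1$; * $s_k(q_j)=q_{\sigma_{k-3}(j)}$, $s_k(p_j)=p_{\sigma_{k-3}(j)}$, $s_k(x_j)=x_{\sigma_{k-3}(j)}$ for $4\le k\le n+2$; * $s_{n+3}(q_j)=q_j$, $s_{n+3}(p_n)=p_n-\varepsilon_{n+3}/q_n$, $s_{n+3}(p_j)=p_j$ $(j\ne n)$, $s_{n+3}(x_i)=x_i$. Each $s_k$ is canonical, i.e. $\{s_k(\varphi),s_k(\psi)\}=s_k(\{\varphi,\psi\})$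 for all $\varphi,\psi\in F$, and the $s_k$ satisfy the fundamental relations for the generators of the affine Weyl group $W(B^{(1)}_{n+3})$: $$s_k^2=1\ (0\le k\le n+3),\qquad (s_ks_l)^2=1\ \bigl(|k-l|>1,\ \{k,l\}\ne\{0,2\}\bigr),\qquad (s_ks_{k+1})^3=1\ (1\le k\le n+1),$$ $$(s_0s_1)^2=1,\qquad (s_0s_2)^3=1,\qquad (s_{n+2}s_{n+3})^4=1.$$ -/

import Mathlib

namespace Garnier

/-- The variables: `eps j`, `q i`, `p i`, `x i` stand for `ε_{j+1}`, `q_{i+1}`, `p_{i+1}`,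
`x_{i+1}` (the indices of `Fin` start at `0`). -/
inductive Var (n : ℕ) : Type
  | eps (j : Fin (n + 3))
  | q (i : Fin n)
  | p (i : Fin n)
  | x (i : Fin n)

noncomputable section

/-- The field `ℂ(ε, q, p, x)` of rational functions. -/
abbrev RatField (n : ℕ) : Type := FractionRing (MvPolynomial (Var n) ℂ)

/-- A variable, as an element of the field of rational functions. -/
def gen {n : ℕ} (v : Var n) : RatField n :=
  algebraMap (MvPolynomial (Var n) ℂ) (RatField n) (MvPolynomial.X v)

abbrev ε {n : ℕ} (j : Fin (n + 3)) : RatField n := gen (.eps j)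
abbrev q {n : ℕ} (i : Fin n) : RatField n := gen (.q i)
abbrev p {n : ℕ} (i : Fin n) : RatField n := gen (.p i)
abbrev x {n : ℕ} (i : Fin n) : RatField n := gen (.x i)

/-- The partial derivative `∂f/∂v` of a rational function, by the quotient rule. -/
def partialDeriv {n : ℕ} (v : Var n) (f : RatField n) : RatField n :=
  let a := IsFractionRing.num (MvPolynomial (Var n) ℂ) f
  let b : MvPolynomial (Var n) ℂ := IsFractionRing.den (MvPolynomial (Var n) ℂ) f
  algebraMap (MvPolynomial (Var n) ℂ) (RatField n)
      (MvPolynomial.pderiv v a * b - a * MvPolynomial.pderiv v b) /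
    algebraMap (MvPolynomial (Var n) ℂ) (RatField n) b ^ 2

/-- The Poisson bracket `∑ⱼ (∂φ/∂pⱼ ∂ψ/∂qⱼ - ∂φ/∂qⱼ ∂ψ/∂pⱼ)`. -/
def poisson {n : ℕ} (φ ψ : RatField n) : RatField n :=
  ∑ j : Fin n, (partialDeriv (.p j) φ * partialDeriv (.q j) ψ -
    partialDeriv (.q j) φ * partialDeriv (.p j) ψ)

/-- A birational transformation is canonical if it preserves the Poisson bracket. -/
def IsCanonical {n : ℕ} (s : RatField n ≃ₐ[ℂ] RatField n) : Prop :=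
  ∀ φ ψ : RatField n, poisson (s φ) (s ψ) = s (poisson φ ψ)

/-- `Q₁ = ∑ q_l p_l + (1 - ∑ ε_l) / 2`. -/
def Q₁ (n : ℕ) : RatField n :=
  ∑ l : Fin n, q l * p l + 1 / 2 * (1 - ∑ l : Fin (n + 3), ε l)

/-- `Q₂ = ∑ q_j - 1`. -/
def Q₂ (n : ℕ) : RatField n := ∑ j : Fin n, q j - 1

/-- `s_k(ε_j)`. For `1 ≤ k ≤ n + 2` the indices of `ε_k` and `ε_{k+1}` in `Fin (n + 3)` are
`k - 1` and `k`. -/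
def imgEps {n : ℕ} (k : Fin (n + 4)) (j : Fin (n + 3)) : RatField n :=
  if h0 : (k : ℕ) = 0 then
    if j = 0 then 1 - ε 1 else if j = 1 then 1 - ε 0 else ε j
  else if h : (k : ℕ) ≤ n + 2 then
    ε (Equiv.swap ⟨k - 1, by omega⟩ ⟨k, by omega⟩ j)
  else
    if (j : ℕ) = n + 2 then -ε j else ε j

/-- For `4 ≤ k ≤ n + 2`, the transposition of `k - 3` and `k - 2` in `{1, …, n}`, which are the
elements `k - 4` and `k - 3` of `Fin n`. -/
def adjSwap {n : ℕ} (k : ℕ) (hk : 4 ≤ k) (hk' : k ≤ n + 2) : Equiv.Perm (Fin n) :=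
  Equiv.swap ⟨k - 4, by omega⟩ ⟨k - 3, by omega⟩

/-- `s_k(q_j)`. -/
def imgQ {n : ℕ} [NeZero n] (k : Fin (n + 4)) (j : Fin n) : RatField n :=
  if (k : ℕ) = 0 then p j * (q j * p j - ε (j.addNat 3)) / (Q₁ n * (Q₁ n + ε 2))
  else if (k : ℕ) = 1 then q j / x j
  else if (k : ℕ) = 2 then q j / Q₂ n
  else if (k : ℕ) = 3 then (if j = 0 then 1 / q 0 else -(q j / q 0))
  else if h : 4 ≤ (k : ℕ) ∧ (k : ℕ) ≤ n + 2 then q (adjSwap k h.1 h.2 j)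
  else q j

/-- `s_k(p_j)`. For `k = 0` it is determined by `s_0(q_j p_j) = ε_{j+3} - q_j p_j`. -/
def imgP {n : ℕ} [NeZero n] (k : Fin (n + 4)) (j : Fin n) : RatField n :=
  if (k : ℕ) = 0 then (ε (j.addNat 3) - q j * p j) / imgQ k j
  else if (k : ℕ) = 1 then x j * p j
  else if (k : ℕ) = 2 then (p j - Q₁ n) * Q₂ n
  else if (k : ℕ) = 3 then (if j = 0 then -(q 0 * Q₁ n) else -(q 0 * p j))
  else if h : 4 ≤ (k : ℕ) ∧ (k : ℕ) ≤ n + 2 then p (adjSwap k h.1 h.2 j)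
  else if (j : ℕ) + 1 = n then p j - ε (j.addNat 3) / q j
  else p j

/-- `s_k(x_i)`. -/
def imgX {n : ℕ} [NeZero n] (k : Fin (n + 4)) (i : Fin n) : RatField n :=
  if (k : ℕ) = 0 then 1 / x i
  else if (k : ℕ) = 1 then 1 / x i
  else if (k : ℕ) = 2 then x i / (x i - 1)
  else if (k : ℕ) = 3 then (if i = 0 then 1 / x 0 else x i / x 0)
  else if h : 4 ≤ (k : ℕ) ∧ (k : ℕ) ≤ n + 2 then x (adjSwap k h.1 h.2 i)
  else x i

/-- The prescribed image of each variable under `s_k`. -/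
def img {n : ℕ} [NeZero n] (k : Fin (n + 4)) : Var n → RatField n
  | .eps j => imgEps k j
  | .q j => imgQ k j
  | .p j => imgP k j
  | .x i => imgX k i

/-- `s 0, …, s (n + 3)` are the transformations given by the prescribed images of the
variables. -/
def IsAction {n : ℕ} [NeZero n] (s : Fin (n + 4) → (RatField n ≃ₐ[ℂ] RatField n)) : Prop :=
  ∀ (k : Fin (n + 4)) (v : Var n), s k (gen v) = img k v

end

end Garnier

namespace Garnier

noncomputable section

variable {n : ℕ}

/-! ### Rational functions and their derivations -/

/-! A homomorphism out of `RatField n` is determined by its values on the variables, which gives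
uniqueness and reduces every relation to an identity on `gen v`. For existence, prescribed images
define an automorphism as soon as they generate the field: as many generators as the transcendence
degree are algebraically independent, so substitution is injective and extends to fractions
(`exists_algEquiv`). It remains to solve for each variable in terms of its images (the `gen_mem`
lemmas).

The generators fall into six kinds: s₀, s₁, s₂, s₃, permutations of the index of `q`, `p`, `x`, `η`,
and a sign change of one `η m`. The formulas involve sums over all indices only through `Q₁` and
`Q₂`, so once the action on `Q₁`, `Q₂` and two auxiliary sums `Q₃`, `Q₄` is known, every relation is
an identity between rational functions of a few quantities. Commutation gives order 2, the braid
identity order 3. The order-4 relation holds because the conjugate of the last generator by the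
preceding one is a sign change of another parameter, and the two sign changes commute.

For canonicity, {φ, ·} is a derivation, and derivations of the field agree when they agree on
variables; hence it suffices to compare brackets of variables (`isCanonical_of_gen`). The `ε` and
`x` are Casimirs whose images are again functions of `ε` and `x`, so only the canonical relations
among images of `q` and `p` require calculation. -/

instance : Finite (Var n) :=
  Finite.of_injective
    (fun v : Var n => (match v with
      | .eps j => Sum.inl j
      | .q i => Sum.inr (0, i)
      | .p i => Sum.inr (1, i)
      | .x i => Sum.inr (2, i) : Fin (n + 3) ⊕ (Fin 3 × Fin n)))
    (by rintro (_ | _ | _ | _) (_ | _ | _ | _) h <;> simp_all)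

theorem algebraicIndependent_gen : AlgebraicIndependent ℂ (gen : Var n → RatField n) :=
  (MvPolynomial.algebraicIndependent_X (Var n) ℂ).map'
    (f := IsScalarTower.toAlgHom ℂ (MvPolynomial (Var n) ℂ) (RatField n))
    (IsFractionRing.injective (MvPolynomial (Var n) ℂ) (RatField n))

theorem algebraMap_eq_aeval_gen (a : MvPolynomial (Var n) ℂ) :
    algebraMap (MvPolynomial (Var n) ℂ) (RatField n) a = MvPolynomial.aeval gen a := by
  have : IsScalarTower.toAlgHom ℂ (MvPolynomial (Var n) ℂ) (RatField n) =
      MvPolynomial.aeval gen := by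
    ext v
    simp [gen]
  exact DFunLike.congr_fun this a

theorem aeval_gen_ne_zero {a : MvPolynomial (Var n) ℂ} (h : a ≠ 0) :
    (MvPolynomial.aeval gen a : RatField n) ≠ 0 := by
  rw [← algebraMap_eq_aeval_gen]
  simpa using h

/-- A polynomial expression in the variables is nonzero if it takes a nonzero value. -/
theorem ne_zero_of_eval {f : RatField n} (a : MvPolynomial (Var n) ℂ) (c : Var n → ℂ)
    (h : MvPolynomial.aeval gen a = f) (hc : MvPolynomial.eval c a ≠ 0) : f ≠ 0 := by
  rw [← h]
  refine aeval_gen_ne_zero fun h0 => hc ?_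
  rw [h0, map_zero]

theorem exists_eq_aeval_div (f : RatField n) : ∃ a b : MvPolynomial (Var n) ℂ, b ≠ 0 ∧
    f = MvPolynomial.aeval gen a / MvPolynomial.aeval gen b := by
  obtain ⟨a, b, hb, rfl⟩ := IsFractionRing.div_surjective (A := MvPolynomial (Var n) ℂ) f
  exact ⟨a, b, nonZeroDivisors.ne_zero hb, by simp only [algebraMap_eq_aeval_gen]⟩

theorem algHom_ext {K : Type*} [Field K] [Algebra ℂ K] {s t : RatField n →ₐ[ℂ] K}
    (h : ∀ v, s (gen v) = t (gen v)) : s = t := by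
  have key : ∀ a : MvPolynomial (Var n) ℂ,
      s (MvPolynomial.aeval gen a) = t (MvPolynomial.aeval gen a) := by
    have : s.comp (MvPolynomial.aeval gen) = t.comp (MvPolynomial.aeval gen) :=
      MvPolynomial.algHom_ext fun v => by simpa using h v
    exact DFunLike.congr_fun this
  refine AlgHom.ext fun f => ?_
  obtain ⟨a, b, -, rfl⟩ := exists_eq_aeval_div f
  simp only [map_div₀, key]

theorem algEquiv_ext {s t : RatField n ≃ₐ[ℂ] RatField n}
    (h : ∀ v, s (gen v) = t (gen v)) : s = t := by
  have := algHom_ext (s := (s : RatField n →ₐ[ℂ] RatField n)) (t := t) h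
  ext f
  exact DFunLike.congr_fun this f

theorem derivation_ext {D E : Derivation ℂ (RatField n) (RatField n)}
    (h : ∀ v, D (gen v) = E (gen v)) : D = E := by
  have key : ∀ a : MvPolynomial (Var n) ℂ,
      D (MvPolynomial.aeval gen a) = E (MvPolynomial.aeval gen a) := by
    intro a
    refine Derivation.eqOn_adjoin (s := Set.range gen) ?_ ?_
    · rintro _ ⟨v, rfl⟩
      exact h v
    · rw [Algebra.adjoin_range_eq_range_aeval]
      exact ⟨a, rfl⟩
  ext f
  obtain ⟨a, b, -, rfl⟩ := exists_eq_aeval_div f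
  simp only [Derivation.leibniz_div, key]

/-- The variables may be substituted by generators of the field of rational functions. -/
theorem exists_algEquiv (f : Var n → RatField n)
    (hf : ∀ v, gen v ∈ IntermediateField.adjoin ℂ (Set.range f)) :
    ∃ s : RatField n ≃ₐ[ℂ] RatField n, ∀ v, s (gen v) = f v := by
  have htop : IntermediateField.adjoin ℂ (Set.range f) = ⊤ := by
    refine eq_top_iff.2 fun g _ => ?_
    obtain ⟨a, b, -, rfl⟩ := exists_eq_aeval_div g
    have key : ∀ a : MvPolynomial (Var n) ℂ,
        MvPolynomial.aeval gen a ∈ IntermediateField.adjoin ℂ (Set.range f) := by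
      intro a
      have h1 : Algebra.adjoin ℂ (Set.range gen) ≤
          (IntermediateField.adjoin ℂ (Set.range f)).toSubalgebra := by
        rw [Algebra.adjoin_le_iff]
        rintro _ ⟨v, rfl⟩
        exact hf v
      refine h1 ?_
      rw [Algebra.adjoin_range_eq_range_aeval]
      exact ⟨a, rfl⟩
    exact div_mem (key a) (key b)
  -- Every element is a quotient of elements of the subalgebra generated by `f`, hence algebraic
  -- over it.
  have halg : Algebra.IsAlgebraic (Algebra.adjoin ℂ (Set.range f)) (RatField n) := by
    refine ⟨fun g => ?_⟩
    have hg : g ∈ IntermediateField.adjoin ℂ (Set.range f) := htop ▸ trivial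
    obtain ⟨a, ha, b, hb, rfl⟩ := IntermediateField.mem_adjoin_iff_div.1 hg
    have h1 := isAlgebraic_algebraMap (R := Algebra.adjoin ℂ (Set.range f)) (A := RatField n)
      ⟨a, ha⟩
    have h2 := isAlgebraic_algebraMap (R := Algebra.adjoin ℂ (Set.range f)) (A := RatField n)
      ⟨b, hb⟩
    rw [div_eq_mul_inv]
    exact h1.mul h2.inv
  -- `f` is indexed by the finite type `Var n`, whose size is at most the transcendence degree
  -- because the variables are independent; a family of that size over which the field is algebraic
  -- is a transcendence basis.
  have hind : AlgebraicIndependent ℂ f :=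
    (Algebra.IsAlgebraic.isTranscendenceBasis_of_le_trdeg_of_finite ℂ f
      algebraicIndependent_gen.cardinalMk_le_trdeg).1
  have hinj : Function.Injective (MvPolynomial.aeval f : MvPolynomial (Var n) ℂ →ₐ[ℂ] RatField n) :=
    hind
  let s : RatField n →ₐ[ℂ] RatField n := IsFractionRing.liftAlgHom hinj
  have hs : ∀ v, s (gen v) = f v := by
    intro v
    simp [s, gen]
  have hsurj : Function.Surjective s := by
    have : IntermediateField.adjoin ℂ (Set.range f) ≤ s.fieldRange := by
      rw [IntermediateField.adjoin_le_iff]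
      rintro _ ⟨v, rfl⟩
      exact ⟨gen v, hs v⟩
    intro g
    exact this (htop ▸ trivial)
  exact ⟨AlgEquiv.ofBijective s ⟨s.toRingHom.injective, hsurj⟩, hs⟩

/-- The definition uses the particular fraction `num / den`. Independence of the representative is
what lets the sum and product rules be checked on arbitrary fractions. -/
theorem partialDeriv_aeval_div (v : Var n) (a b : MvPolynomial (Var n) ℂ) (hb : b ≠ 0) :
    partialDeriv v (MvPolynomial.aeval gen a / MvPolynomial.aeval gen b) =
      (MvPolynomial.aeval gen (MvPolynomial.pderiv v a) * MvPolynomial.aeval gen b -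
        MvPolynomial.aeval gen a * MvPolynomial.aeval gen (MvPolynomial.pderiv v b)) /
        MvPolynomial.aeval gen b ^ 2 := by
  set f : RatField n := MvPolynomial.aeval gen a / MvPolynomial.aeval gen b with hf
  set c := IsFractionRing.num (MvPolynomial (Var n) ℂ) f with hc
  set d : MvPolynomial (Var n) ℂ := (IsFractionRing.den (MvPolynomial (Var n) ℂ) f).1 with hd
  have hd0 : d ≠ 0 := nonZeroDivisors.ne_zero (IsFractionRing.den _ f).2
  have hb' := aeval_gen_ne_zero hb
  have hd' := aeval_gen_ne_zero hd0
  have hcd : f = MvPolynomial.aeval gen c / MvPolynomial.aeval gen d := by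
    simp only [← algebraMap_eq_aeval_gen]
    exact (IsFractionRing.mk'_num_den' (MvPolynomial (Var n) ℂ) f).symm
  have h1 : (MvPolynomial.aeval gen a : RatField n) * MvPolynomial.aeval gen d =
      MvPolynomial.aeval gen c * MvPolynomial.aeval gen b := by
    rw [hcd] at hf
    rwa [eq_comm, div_eq_div_iff hb' hd'] at hf
  -- Cross-multiplication descends to polynomials by algebraic independence, so `pderiv` can be
  -- applied to it.
  have h2 : a * d = c * b := by
    apply algebraicIndependent_gen (n := n)
    simpa using h1
  have h3 := congrArg (MvPolynomial.aeval (gen : Var n → RatField n))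
    (congrArg (MvPolynomial.pderiv v) h2)
  simp only [Derivation.leibniz, smul_eq_mul, map_add, map_mul] at h3
  unfold partialDeriv
  simp only [algebraMap_eq_aeval_gen, ← hc, ← hd, map_sub, map_mul]
  rw [div_eq_div_iff (pow_ne_zero 2 hd') (pow_ne_zero 2 hb')]
  linear_combination (-(MvPolynomial.aeval gen b * MvPolynomial.aeval gen d)) * h3 +
    (MvPolynomial.aeval gen (MvPolynomial.pderiv v b) * MvPolynomial.aeval gen d +
      MvPolynomial.aeval gen b * MvPolynomial.aeval gen (MvPolynomial.pderiv v d)) * h1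

theorem partialDeriv_add (v : Var n) (f g : RatField n) :
    partialDeriv v (f + g) = partialDeriv v f + partialDeriv v g := by
  obtain ⟨a, b, hb, rfl⟩ := exists_eq_aeval_div f
  obtain ⟨c, d, hd, rfl⟩ := exists_eq_aeval_div g
  have hb' := aeval_gen_ne_zero hb
  have hd' := aeval_gen_ne_zero hd
  rw [div_add_div _ _ hb' hd', ← map_mul, ← map_mul, ← map_mul, ← map_add,
    partialDeriv_aeval_div v _ _ (mul_ne_zero hb hd), partialDeriv_aeval_div v _ _ hb,
    partialDeriv_aeval_div v _ _ hd]
  simp only [Derivation.leibniz, smul_eq_mul, map_add, map_mul]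
  generalize (MvPolynomial.aeval gen b : RatField n) = B at *
  generalize (MvPolynomial.aeval gen d : RatField n) = D at *
  rw [div_add_div _ _ (pow_ne_zero 2 hb') (pow_ne_zero 2 hd'), div_eq_div_iff
    (pow_ne_zero 2 (mul_ne_zero hb' hd')) (mul_ne_zero (pow_ne_zero 2 hb') (pow_ne_zero 2 hd'))]
  ring

theorem partialDeriv_mul (v : Var n) (f g : RatField n) :
    partialDeriv v (f * g) = f * partialDeriv v g + g * partialDeriv v f := by
  obtain ⟨a, b, hb, rfl⟩ := exists_eq_aeval_div f
  obtain ⟨c, d, hd, rfl⟩ := exists_eq_aeval_div g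
  have hb' := aeval_gen_ne_zero hb
  have hd' := aeval_gen_ne_zero hd
  rw [div_mul_div_comm, ← map_mul, ← map_mul,
    partialDeriv_aeval_div v _ _ (mul_ne_zero hb hd), partialDeriv_aeval_div v _ _ hb,
    partialDeriv_aeval_div v _ _ hd]
  simp only [Derivation.leibniz, smul_eq_mul, map_add, map_mul]
  generalize (MvPolynomial.aeval gen b : RatField n) = B at *
  generalize (MvPolynomial.aeval gen d : RatField n) = D at *
  rw [div_mul_div_comm, div_mul_div_comm, div_add_div _ _
    (mul_ne_zero hb' (pow_ne_zero 2 hd')) (mul_ne_zero hd' (pow_ne_zero 2 hb')), div_eq_div_iff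
    (pow_ne_zero 2 (mul_ne_zero hb' hd'))
    (mul_ne_zero (mul_ne_zero hb' (pow_ne_zero 2 hd')) (mul_ne_zero hd' (pow_ne_zero 2 hb')))]
  ring

theorem partialDeriv_gen [DecidableEq (Var n)] (v w : Var n) :
    partialDeriv v (gen w) = if v = w then 1 else 0 := by
  have h := partialDeriv_aeval_div v (MvPolynomial.X w) 1 one_ne_zero
  simp only [MvPolynomial.aeval_X, map_one, div_one, mul_one, Derivation.map_one_eq_zero,
    map_zero, mul_zero, sub_zero, one_pow] at h
  rw [h]
  by_cases hvw : v = w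
  · subst hvw; simp
  · rw [MvPolynomial.pderiv_X_of_ne (fun h => hvw h.symm), if_neg hvw, map_zero]

theorem partialDeriv_algebraMap (v : Var n) (r : ℂ) :
    partialDeriv v (algebraMap ℂ (RatField n) r) = 0 := by
  have h := partialDeriv_aeval_div v (MvPolynomial.C r) 1 one_ne_zero
  simpa using h

/-- The partial derivative as a derivation of the field of rational functions. -/
def pd (v : Var n) : Derivation ℂ (RatField n) (RatField n) :=
  Derivation.mk'
    { toFun := partialDeriv v
      map_add' := partialDeriv_add v
      map_smul' := fun r f => by
        rw [Algebra.smul_def, partialDeriv_mul, partialDeriv_algebraMap, mul_zero, add_zero,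
          RingHom.id_apply, Algebra.smul_def] }
    (partialDeriv_mul v)

theorem pd_apply (v : Var n) (f : RatField n) : pd v f = partialDeriv v f := rfl

/-- The Hamiltonian derivation `ψ ↦ {φ, ψ}`. -/
def ham (φ : RatField n) : Derivation ℂ (RatField n) (RatField n) :=
  ∑ j : Fin n, (pd (.p j) φ • pd (.q j) - pd (.q j) φ • pd (.p j))

theorem ham_apply (φ ψ : RatField n) : ham φ ψ = poisson φ ψ := by
  simp only [ham, poisson, ← pd_apply]
  have : ∀ (t : Finset (Fin n)) (D : Fin n → Derivation ℂ (RatField n) (RatField n)),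
      (∑ j ∈ t, D j) ψ = ∑ j ∈ t, D j ψ := by
    intro t D
    rw [← Derivation.coeFnAddMonoidHom_apply, map_sum, Finset.sum_apply]
    rfl
  rw [this]
  rfl

theorem poisson_antisymm (φ ψ : RatField n) : poisson φ ψ = -poisson ψ φ := by
  unfold poisson
  rw [← Finset.sum_neg_distrib]
  exact Finset.sum_congr rfl fun j _ => by ring

/-! ### Calculus of Poisson brackets -/

section Poisson

variable (f g h : RatField n)

theorem poisson_add_right : poisson f (g + h) = poisson f g + poisson f h := by
  simp only [← ham_apply, map_add]

theorem poisson_sub_right : poisson f (g - h) = poisson f g - poisson f h := by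
  simp only [← ham_apply, map_sub]

theorem poisson_neg_right : poisson f (-g) = -poisson f g := by
  simp only [← ham_apply, map_neg]

theorem poisson_mul_right : poisson f (g * h) = g * poisson f h + h * poisson f g := by
  simp only [← ham_apply, Derivation.leibniz, smul_eq_mul]

theorem poisson_div_right :
    poisson f (g / h) = (h * poisson f g - g * poisson f h) / h ^ 2 := by
  simp only [← ham_apply, Derivation.leibniz_div, smul_eq_mul]
  rw [div_eq_inv_mul, inv_pow]

theorem poisson_one_right : poisson f 1 = 0 := by
  simp only [← ham_apply, Derivation.map_one_eq_zero]

theorem poisson_sum_right {ι : Type*} (t : Finset ι) (F : ι → RatField n) :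
    poisson f (∑ i ∈ t, F i) = ∑ i ∈ t, poisson f (F i) := by
  simp only [← ham_apply, map_sum]

theorem poisson_add_left : poisson (f + g) h = poisson f h + poisson g h := by
  rw [poisson_antisymm, poisson_add_right, poisson_antisymm h f, poisson_antisymm h g]
  ring

theorem poisson_sub_left : poisson (f - g) h = poisson f h - poisson g h := by
  rw [poisson_antisymm, poisson_sub_right, poisson_antisymm h f, poisson_antisymm h g]
  ring

theorem poisson_neg_left : poisson (-f) g = -poisson f g := by
  rw [poisson_antisymm, poisson_neg_right, poisson_antisymm g f, neg_neg]

theorem poisson_mul_left : poisson (f * g) h = f * poisson g h + g * poisson f h := by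
  rw [poisson_antisymm, poisson_mul_right, poisson_antisymm h f, poisson_antisymm h g]
  ring

theorem poisson_div_left :
    poisson (f / g) h = (g * poisson f h - f * poisson g h) / g ^ 2 := by
  rw [poisson_antisymm, poisson_div_right, poisson_antisymm h f, poisson_antisymm h g]
  ring

theorem poisson_one_left : poisson 1 f = 0 := by
  rw [poisson_antisymm, poisson_one_right, neg_zero]

theorem poisson_sum_left {ι : Type*} (t : Finset ι) (F : ι → RatField n) :
    poisson (∑ i ∈ t, F i) f = ∑ i ∈ t, poisson (F i) f := by
  rw [poisson_antisymm, poisson_sum_right, ← Finset.sum_neg_distrib]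
  exact Finset.sum_congr rfl fun i _ => (poisson_antisymm _ _).symm

theorem poisson_self : poisson f f = 0 := by
  have h := poisson_antisymm f f
  exact self_eq_neg.1 h

open Classical in
theorem poisson_eps_left (j : Fin (n + 3)) : poisson (ε j) f = 0 := by
  simp [poisson, partialDeriv_gen]

theorem poisson_eps_right (j : Fin (n + 3)) : poisson f (ε j) = 0 := by
  rw [poisson_antisymm, poisson_eps_left, neg_zero]

open Classical in
theorem poisson_x_left (j : Fin n) : poisson (x j) f = 0 := by
  simp [poisson, partialDeriv_gen]

theorem poisson_x_right (j : Fin n) : poisson f (x j) = 0 := by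
  rw [poisson_antisymm, poisson_x_left, neg_zero]

open Classical in
theorem poisson_p_left (j : Fin n) : poisson (p j) f = partialDeriv (.q j) f := by
  simp [poisson, partialDeriv_gen]

open Classical in
theorem poisson_q_left (j : Fin n) : poisson (q j) f = -partialDeriv (.p j) f := by
  simp [poisson, partialDeriv_gen]

theorem poisson_q_q (i j : Fin n) : poisson (q i : RatField n) (q j) = 0 := by
  classical
  rw [poisson_q_left, partialDeriv_gen]
  simp

theorem poisson_p_p (i j : Fin n) : poisson (p i : RatField n) (p j) = 0 := by
  classical
  rw [poisson_p_left, partialDeriv_gen]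
  simp

theorem poisson_p_q (i j : Fin n) : poisson (p i : RatField n) (q j) = if i = j then 1 else 0 := by
  classical
  rw [poisson_p_left, partialDeriv_gen]
  simp

theorem poisson_q_p (i j : Fin n) :
    poisson (q i : RatField n) (p j) = if i = j then -1 else 0 := by
  rw [poisson_antisymm, poisson_p_q]
  split_ifs <;> simp_all

end Poisson

/-- A birational transformation is canonical if it preserves the brackets of the variables. -/
theorem isCanonical_of_gen {s : RatField n ≃ₐ[ℂ] RatField n}
    (h : ∀ v w, poisson (s (gen v)) (s (gen w)) = s (poisson (gen v) (gen w))) :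
    IsCanonical s := by
  -- The bracket transported back along `s`: ψ ↦ s⁻¹{s φ, s ψ}. Canonicity says that it equals `ham
  -- φ`.
  let D (φ : RatField n) : Derivation ℂ (RatField n) (RatField n) :=
    Derivation.mk' (s.symm.toLinearMap ∘ₗ (ham (s φ)).toLinearMap ∘ₗ s.toLinearMap) (by
      intro a b
      simp [Derivation.leibniz])
  have hD (φ ψ : RatField n) : D φ ψ = s.symm (poisson (s φ) (s ψ)) := by
    rw [← ham_apply]; rfl
  have h1 (v : Var n) : D (gen v) = ham (gen v) :=
    derivation_ext fun w => by rw [hD, h, AlgEquiv.symm_apply_apply, ham_apply]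
  -- Extensionality has freed the second argument; antisymmetry exchanges the arguments, and
  -- extensionality then frees the first.
  have h2 (φ : RatField n) : D φ = ham φ := by
    refine derivation_ext fun v => ?_
    have := DFunLike.congr_fun (h1 v) φ
    rw [hD, poisson_antisymm, map_neg, ← hD, this, ham_apply, ham_apply,
      ← poisson_antisymm]
  intro φ ψ
  have := DFunLike.congr_fun (h2 φ) ψ
  rw [hD, ham_apply] at this
  rw [← this, AlgEquiv.apply_symm_apply]

theorem isCanonical_of_forall {s : RatField n ≃ₐ[ℂ] RatField n}
    (heps : ∀ j g, poisson (s (ε j)) g = 0) (hx : ∀ j g, poisson (s (x j)) g = 0)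
    (hqq : ∀ i j, poisson (s (q i)) (s (q j)) = 0) (hpp : ∀ i j, poisson (s (p i)) (s (p j)) = 0)
    (hpq : ∀ i j, poisson (s (p i)) (s (q j)) = if i = j then 1 else 0) : IsCanonical s := by
  have heps' : ∀ j g, poisson g (s (ε j)) = 0 := fun j g => by
    rw [poisson_antisymm, heps, neg_zero]
  have hx' : ∀ j g, poisson g (s (x j)) = 0 := fun j g => by
    rw [poisson_antisymm, hx, neg_zero]
  have hqp : ∀ i j, poisson (s (q i)) (s (p j)) = if i = j then -1 else 0 := fun i j => by
    rw [poisson_antisymm, hpq]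
    split_ifs <;> simp_all
  refine isCanonical_of_gen ?_
  rintro (i | i | i | i) (j | j | j | j) <;>
    simp only [heps, heps', hx, hx', poisson_eps_left, poisson_eps_right, poisson_x_left,
      poisson_x_right, map_zero, hqq, hpp, hpq, hqp, poisson_q_q, poisson_p_p, poisson_p_q,
      poisson_q_p]
  all_goals split_ifs <;> simp

/-! ### The functions `Q₁` and `Q₂` -/

/-- The parameter `ε_{j+3}` attached to the pair `q_j, p_j`. -/
abbrev η (j : Fin n) : RatField n := ε (j.addNat 3)

/-- The first three parameters are moved separately by s₀, s₁, s₂ and s₃, while the remaining ones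
are indexed like `q` and `p`. -/
theorem Q₁_eq : Q₁ n =
    ∑ j : Fin n, q j * p j + 1 / 2 * (1 - ε 0 - ε 1 - ε 2 - ∑ j : Fin n, η j) := by
  rw [Q₁, Fin.sum_univ_succ, Fin.sum_univ_succ, Fin.sum_univ_succ]
  have h : ∀ j : Fin n, (ε j.succ.succ.succ : RatField n) = η j := fun _ => rfl
  have h1 : (ε (Fin.succ (0 : Fin (n + 2))) : RatField n) = ε 1 := rfl
  have h2 : (ε (Fin.succ (Fin.succ (0 : Fin (n + 1)))) : RatField n) = ε 2 := rfl
  simp only [h, h1, h2]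
  ring

theorem poisson_half_left (f : RatField n) : poisson (1 / 2) f = 0 := by
  rw [poisson_div_left, ← one_add_one_eq_two, poisson_add_left, poisson_one_left]
  simp

/-- Up to Casimirs `Q₁` is ∑ q p, whose Hamiltonian derivation is the Euler field giving `q` weight
1 and `p` weight -1. -/
theorem poisson_Q₁_q (j : Fin n) : poisson (Q₁ n) (q j) = q j := by
  simp only [Q₁_eq, poisson_add_left, poisson_sum_left, poisson_mul_left, poisson_half_left,
    poisson_sub_left, poisson_q_q, poisson_p_q, poisson_eps_left, poisson_one_left]
  simp

theorem poisson_Q₁_p (j : Fin n) : poisson (Q₁ n) (p j) = -p j := by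
  simp only [Q₁_eq, poisson_add_left, poisson_sum_left, poisson_mul_left, poisson_half_left,
    poisson_sub_left, poisson_p_p, poisson_q_p, poisson_eps_left, poisson_one_left]
  simp

theorem poisson_q_Q₁ (j : Fin n) : poisson (q j) (Q₁ n) = -q j := by
  rw [poisson_antisymm, poisson_Q₁_q]

theorem poisson_p_Q₁ (j : Fin n) : poisson (p j) (Q₁ n) = p j := by
  rw [poisson_antisymm, poisson_Q₁_p, neg_neg]

theorem poisson_Q₂_q (j : Fin n) : poisson (Q₂ n) (q j) = 0 := by
  simp [Q₂, poisson_sub_left, poisson_sum_left, poisson_q_q, poisson_one_left]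

theorem poisson_q_Q₂ (j : Fin n) : poisson (q j) (Q₂ n) = 0 := by
  rw [poisson_antisymm, poisson_Q₂_q, neg_zero]

theorem poisson_Q₂_p (j : Fin n) : poisson (Q₂ n) (p j) = -1 := by
  simp [Q₂, poisson_sub_left, poisson_sum_left, poisson_q_p, poisson_one_left]

theorem poisson_p_Q₂ (j : Fin n) : poisson (p j) (Q₂ n) = 1 := by
  rw [poisson_antisymm, poisson_Q₂_p, neg_neg]

theorem poisson_Q₁_Q₂ : poisson (Q₁ n) (Q₂ n) = Q₂ n + 1 := by
  simp [Q₂, poisson_sub_right, poisson_sum_right, poisson_Q₁_q, poisson_one_right]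

theorem poisson_Q₂_Q₁ : poisson (Q₂ n) (Q₁ n) = -(Q₂ n + 1) := by
  rw [poisson_antisymm, poisson_Q₁_Q₂]

theorem gen_ne_zero (v : Var n) : (gen v : RatField n) ≠ 0 :=
  ne_zero_of_eval (MvPolynomial.X v) 1 (by simp) (by simp)

theorem x_sub_one_ne_zero (j : Fin n) : (x j - 1 : RatField n) ≠ 0 :=
  ne_zero_of_eval (MvPolynomial.X (.x j) - 1) 0 (by simp) (by simp)

theorem x_sub_x_ne_zero {i j : Fin n} (h : i ≠ j) : (x i - x j : RatField n) ≠ 0 := by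
  classical
  exact ne_zero_of_eval (MvPolynomial.X (.x i) - MvPolynomial.X (.x j))
    (Pi.single (.x i) 1) (by simp) (by simp [h.symm])

theorem mul_sub_eta_ne_zero (j : Fin n) : (q j * p j - η j : RatField n) ≠ 0 :=
  ne_zero_of_eval (MvPolynomial.X (.q j) * MvPolynomial.X (.p j) - MvPolynomial.X (.eps (j.addNat 3)))
    (fun v => match v with
      | .eps _ => 1
      | _ => 0) (by simp) (by simp)

theorem Q₂_ne_zero : Q₂ n ≠ 0 :=
  ne_zero_of_eval (∑ j, MvPolynomial.X (.q j) - 1) 0 (by simp [Q₂]) (by simp)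

theorem algebraMap_two : algebraMap ℂ (RatField n) 2 = 2 := map_ofNat _ 2

theorem Q₁_ne_zero : Q₁ n ≠ 0 :=
  ne_zero_of_eval (∑ j, MvPolynomial.X (.q j) * MvPolynomial.X (.p j) +
    MvPolynomial.C (1 / 2) * (1 - ∑ j, MvPolynomial.X (.eps j))) 0
    (by simp [Q₁, algebraMap_two]) (by simp)

theorem Q₁_add_ne_zero : Q₁ n + ε 2 ≠ 0 :=
  ne_zero_of_eval (∑ j, MvPolynomial.X (.q j) * MvPolynomial.X (.p j) +
    MvPolynomial.C (1 / 2) * (1 - ∑ j, MvPolynomial.X (.eps j)) + MvPolynomial.X (.eps 2)) 0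
    (by simp [Q₁, algebraMap_two]) (by simp)

theorem gen_induction {P : RatField n → Prop} (h0 : P (ε 0)) (h1 : P (ε 1)) (h2 : P (ε 2))
    (hη : ∀ j, P (η j)) (hq : ∀ j, P (q j)) (hp : ∀ j, P (p j)) (hx : ∀ j, P (x j)) (v : Var n) :
    P (gen v) := by
  rcases v with j | j | j | j
  · refine Fin.cases h0 (Fin.cases h1 (Fin.cases h2 ?_)) j
    exact hη
  · exact hq j
  · exact hp j
  · exact hx j

/-! ### The six kinds of transformations -/

theorem algEquiv_ext_gen {s t : RatField n ≃ₐ[ℂ] RatField n} (h0 : s (ε 0) = t (ε 0))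
    (h1 : s (ε 1) = t (ε 1)) (h2 : s (ε 2) = t (ε 2)) (hη : ∀ j, s (η j) = t (η j))
    (hq : ∀ j, s (q j) = t (q j)) (hp : ∀ j, s (p j) = t (p j)) (hx : ∀ j, s (x j) = t (x j)) :
    s = t :=
  algEquiv_ext (gen_induction (P := fun f => s f = t f) h0 h1 h2 hη hq hp hx)

/-- The transformation `s₀`. -/
structure IsS0 (s : RatField n → RatField n) : Prop where
  map_eps0 : s (ε 0) = 1 - ε 1
  map_eps1 : s (ε 1) = 1 - ε 0
  map_eps2 : s (ε 2) = ε 2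
  map_eta : ∀ j, s (η j) = η j
  map_q : ∀ j, s (q j) = p j * (q j * p j - η j) / (Q₁ n * (Q₁ n + ε 2))
  map_p : ∀ j, s (p j) = -(Q₁ n * (Q₁ n + ε 2) / p j)
  map_x : ∀ j, s (x j) = 1 / x j

/-- The transformation `s₁`. -/
structure IsS1 (s : RatField n → RatField n) : Prop where
  map_eps0 : s (ε 0) = ε 1
  map_eps1 : s (ε 1) = ε 0
  map_eps2 : s (ε 2) = ε 2
  map_eta : ∀ j, s (η j) = η j
  map_q : ∀ j, s (q j) = q j / x j
  map_p : ∀ j, s (p j) = x j * p j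
  map_x : ∀ j, s (x j) = 1 / x j

/-- The transformation `s₂`. -/
structure IsS2 (s : RatField n → RatField n) : Prop where
  map_eps0 : s (ε 0) = ε 0
  map_eps1 : s (ε 1) = ε 2
  map_eps2 : s (ε 2) = ε 1
  map_eta : ∀ j, s (η j) = η j
  map_q : ∀ j, s (q j) = q j / Q₂ n
  map_p : ∀ j, s (p j) = (p j - Q₁ n) * Q₂ n
  map_x : ∀ j, s (x j) = x j / (x j - 1)

/-- The transformation `s₃`. -/
structure IsS3 [NeZero n] (s : RatField n → RatField n) : Prop where
  map_eps0 : s (ε 0) = ε 0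
  map_eps1 : s (ε 1) = ε 1
  map_eps2 : s (ε 2) = η 0
  map_eta_zero : s (η 0) = ε 2
  map_eta : ∀ j, j ≠ 0 → s (η j) = η j
  map_q_zero : s (q 0) = 1 / q 0
  map_q : ∀ j, j ≠ 0 → s (q j) = -(q j / q 0)
  map_p_zero : s (p 0) = -(q 0 * Q₁ n)
  map_p : ∀ j, j ≠ 0 → s (p j) = -(q 0 * p j)
  map_x_zero : s (x 0) = 1 / x 0
  map_x : ∀ j, j ≠ 0 → s (x j) = x j / x 0

/-- The transformation permuting the indices of `q`, `p`, `x` and `η` by `σ`. -/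
structure IsPerm (σ : Equiv.Perm (Fin n)) (s : RatField n → RatField n) : Prop where
  map_eps0 : s (ε 0) = ε 0
  map_eps1 : s (ε 1) = ε 1
  map_eps2 : s (ε 2) = ε 2
  map_eta : ∀ j, s (η j) = η (σ j)
  map_q : ∀ j, s (q j) = q (σ j)
  map_p : ∀ j, s (p j) = p (σ j)
  map_x : ∀ j, s (x j) = x (σ j)

/-- The transformation that changes the sign of `η m`. For the last index `m` it is `s_{n+3}`. -/
structure IsSignChange (m : Fin n) (s : RatField n → RatField n) : Prop where
  map_eps0 : s (ε 0) = ε 0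
  map_eps1 : s (ε 1) = ε 1
  map_eps2 : s (ε 2) = ε 2
  map_eta_self : s (η m) = -η m
  map_eta : ∀ j, j ≠ m → s (η j) = η j
  map_q : ∀ j, s (q j) = q j
  map_p_self : s (p m) = p m - η m / q m
  map_p : ∀ j, j ≠ m → s (p j) = p j
  map_x : ∀ j, s (x j) = x j

/-- The numerator of `s₀(Q₂)`. -/
def Q₃ (n : ℕ) : RatField n :=
  ∑ j : Fin n, p j * (q j * p j - η j) - Q₁ n * (Q₁ n + ε 2)

/-- The function `s₁(Q₂)`. -/
def Q₄ (n : ℕ) : RatField n := ∑ j : Fin n, q j / x j - 1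

/-! ### Action of the generators on `Q₁`, `Q₂`, `Q₃` and `Q₄`. -/

section

variable {s : RatField n ≃ₐ[ℂ] RatField n}

theorem IsS0.map_q_mul_map_p {s : RatField n → RatField n} (h : IsS0 s) (j : Fin n) :
    s (q j) * s (p j) = η j - q j * p j := by
  have := gen_ne_zero (Var.p j)
  have := Q₁_ne_zero (n := n)
  have := Q₁_add_ne_zero (n := n)
  rw [h.map_q, h.map_p]
  field_simp
  ring

/-- Consequently s₀ exchanges the factors of `Q₁ n * (Q₁ n + ε 2)` up to sign and fixes this
product, the common denominator in its formulas. -/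
theorem IsS0.map_Q₁ (h : IsS0 s) : s (Q₁ n) = -Q₁ n - ε 2 := by
  simp only [Q₁_eq, map_add, map_sum, map_mul, map_sub, map_div₀, map_one, map_ofNat, h.map_q_mul_map_p,
    h.map_eps0, h.map_eps1, h.map_eps2, h.map_eta, Finset.sum_sub_distrib]
  ring

theorem IsS0.map_Q₂ (h : IsS0 s) : s (Q₂ n) = Q₃ n / (Q₁ n * (Q₁ n + ε 2)) := by
  have := Q₁_ne_zero (n := n)
  have := Q₁_add_ne_zero (n := n)
  simp only [Q₂, Q₃, map_sub, map_sum, map_one, h.map_q]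
  rw [← Finset.sum_div, sub_div, div_self (by positivity)]

/-- Each summand p(qp - η) is, up to the invariant factor Q₁(Q₁ + ε₂), the image of `q j` and is
sent back to `q j`. -/
theorem IsS0.map_Q₃ (h : IsS0 s) : s (Q₃ n) = Q₁ n * (Q₁ n + ε 2) * Q₂ n := by
  have h1 := Q₁_ne_zero (n := n)
  have h2 := Q₁_add_ne_zero (n := n)
  have key : ∀ j : Fin n, s (p j * (q j * p j - η j)) =
      Q₁ n * (Q₁ n + ε 2) * q j := by
    intro j
    have := gen_ne_zero (Var.p j)
    rw [map_mul, map_sub, map_mul, h.map_q_mul_map_p, h.map_eta, h.map_p]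
    field_simp
    ring
  simp only [Q₃, Q₂, map_sub, map_sum, key, ← Finset.mul_sum]
  simp only [map_mul, map_add, h.map_Q₁, h.map_eps2]
  ring

theorem IsS1.map_Q₁ (h : IsS1 s) : s (Q₁ n) = Q₁ n := by
  have key : ∀ j : Fin n, s (q j) * s (p j) = q j * p j := by
    intro j
    have := gen_ne_zero (Var.x j)
    rw [h.map_q, h.map_p]
    field_simp
  simp only [Q₁_eq, map_add, map_sum, map_mul, map_sub, map_div₀, map_one, map_ofNat, key,
    h.map_eps0, h.map_eps1, h.map_eps2, h.map_eta]
  ring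

theorem IsS1.map_Q₂ (h : IsS1 s) : s (Q₂ n) = Q₄ n := by
  simp only [Q₂, Q₄, map_sub, map_sum, map_one, h.map_q]

theorem IsS2.map_Q₁ (h : IsS2 s) : s (Q₁ n) = -(Q₁ n * Q₂ n) := by
  have key : ∀ j : Fin n, s (q j) * s (p j) =
      q j * p j - q j * Q₁ n := by
    intro j
    have := Q₂_ne_zero (n := n)
    rw [h.map_q, h.map_p]
    field_simp
  have e : Q₁ n * Q₂ n =
      (∑ j, q j) * Q₁ n - Q₁ n := by rw [Q₂]; ring
  rw [e]
  conv_lhs => rw [Q₁_eq]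
  simp only [map_add, map_sum, map_mul, map_sub, map_div₀, map_one, map_ofNat, key,
    h.map_eps0, h.map_eps1, h.map_eps2, h.map_eta, Finset.sum_sub_distrib, ← Finset.sum_mul]
  linear_combination -Q₁_eq (n := n)

theorem IsS2.map_Q₂ (h : IsS2 s) : s (Q₂ n) = 1 / Q₂ n := by
  have h2 := Q₂_ne_zero (n := n)
  have e : ∑ j, q j = Q₂ n + 1 := by rw [Q₂]; ring
  rw [Q₂]
  simp only [map_sub, map_sum, map_one, h.map_q]
  rw [← Q₂, ← Finset.sum_div, e]
  field_simp
  ring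

theorem IsS2.map_Q₃ (h : IsS2 s) :
    s (Q₃ n) = Q₂ n * (Q₃ n + Q₁ n * (1 - ε 0)) := by
  have h2 := Q₂_ne_zero (n := n)
  have key : ∀ j : Fin n, s (p j * (q j * p j - η j)) =
      Q₂ n * (p j * (q j * p j - η j)
        - 2 * Q₁ n * (q j * p j) +
        Q₁ n ^ 2 * q j + Q₁ n * η j) := by
    intro j
    simp only [map_mul, map_sub, h.map_q, h.map_p, h.map_eta]
    field_simp
    ring
  have e : ∑ j, q j = Q₂ n + 1 := by rw [Q₂]; ring
  have e3 : ∑ j : Fin n, p j * (q j * p j - η j) =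
    Q₃ n + Q₁ n * (Q₁ n + ε 2) := by rw [Q₃]; ring
  rw [Q₃]
  rw [map_sub, map_sum]
  simp only [key, map_mul, map_add, h.map_Q₁, h.map_eps2]
  simp only [← Finset.mul_sum, Finset.sum_add_distrib, Finset.sum_sub_distrib, e, e3]
  -- The leftover sums ∑ q p and ∑ η occur only in the combination ∑ q p - ½ ∑ η, which `Q₁_eq`
  -- eliminates.
  linear_combination 2 * Q₁ n * Q₂ n * Q₁_eq (n := n)

theorem IsS2.map_Q₄ (h : IsS2 s) : s (Q₄ n) = -(Q₄ n / Q₂ n) := by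
  have h2 := Q₂_ne_zero (n := n)
  have key : ∀ j : Fin n, s (q j / x j) =
      (q j - q j / x j) / Q₂ n := by
    intro j
    have := gen_ne_zero (Var.x j)
    have := x_sub_one_ne_zero j
    rw [map_div₀, h.map_q, h.map_x]
    field_simp
  have e : ∑ j, q j = Q₂ n + 1 := by rw [Q₂]; ring
  simp only [Q₄, map_sub, map_sum, map_one, key, ← Finset.sum_div,
    Finset.sum_sub_distrib, e]
  field_simp
  ring

theorem sum_eq_zero_add [NeZero n] (f : Fin n → RatField n) :
    ∑ j, f j = f 0 + ∑ j ∈ Finset.univ.erase 0, f j :=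
  (Finset.add_sum_erase _ _ (Finset.mem_univ 0)).symm

/-- The products q_j p_j with j ≠ 0 and the sum of the parameters are invariant, while q₀p₀ becomes
-Q₁; replacing that one term of `Q₁` leaves -q₀p₀. -/
theorem IsS3.map_Q₁ [NeZero n] (h : IsS3 s) : s (Q₁ n) = -(q 0 * p 0) := by
  have hq := gen_ne_zero (Var.q (0 : Fin n))
  have key : ∑ j ∈ Finset.univ.erase (0 : Fin n), s (q j) * s (p j) =
      ∑ j ∈ Finset.univ.erase 0, q j * p j := by
    refine Finset.sum_congr rfl fun j hj => ?_
    rw [h.map_q j (Finset.ne_of_mem_erase hj), h.map_p j (Finset.ne_of_mem_erase hj)]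
    field_simp
  have key' : ∑ j ∈ Finset.univ.erase (0 : Fin n), s (η j) = ∑ j ∈ Finset.univ.erase 0, η j :=
    Finset.sum_congr rfl fun j hj => h.map_eta j (Finset.ne_of_mem_erase hj)
  have e := Q₁_eq (n := n)
  rw [sum_eq_zero_add, sum_eq_zero_add] at e
  conv_lhs => rw [e]
  simp only [map_add, map_sum, map_mul, map_sub, map_div₀, map_one, map_ofNat, key, key',
    h.map_eps0, h.map_eps1, h.map_eps2, h.map_eta_zero, h.map_q_zero, h.map_p_zero]
  field_simp
  linear_combination -2 * e

theorem IsS3.map_Q₂ [NeZero n] (h : IsS3 s) : s (Q₂ n) = -(Q₂ n / q 0) := by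
  have hq := gen_ne_zero (Var.q (0 : Fin n))
  have key : ∑ j ∈ Finset.univ.erase (0 : Fin n), s (q j) =
      -((∑ j ∈ Finset.univ.erase 0, q j) / q 0) := by
    rw [Finset.sum_div, ← Finset.sum_neg_distrib]
    exact Finset.sum_congr rfl fun j hj => h.map_q j (Finset.ne_of_mem_erase hj)
  rw [Q₂, sum_eq_zero_add]
  simp only [map_add, map_sum, map_sub, map_one, key, h.map_q_zero]
  field_simp
  ring

theorem IsPerm.map_Q₁ {σ : Equiv.Perm (Fin n)} (h : IsPerm σ s) : s (Q₁ n) = Q₁ n := by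
  simp only [Q₁_eq, map_add, map_sum, map_mul, map_sub, map_div₀, map_one, map_ofNat,
    h.map_eps0, h.map_eps1, h.map_eps2, h.map_eta, h.map_q, h.map_p]
  rw [Equiv.sum_comp σ (fun j => η j), Equiv.sum_comp σ (fun j => q j * p j)]

theorem IsPerm.map_Q₂ {σ : Equiv.Perm (Fin n)} (h : IsPerm σ s) : s (Q₂ n) = Q₂ n := by
  simp only [Q₂, map_sum, map_sub, map_one, h.map_q]
  rw [Equiv.sum_comp σ (fun j => q j)]

/-- The product q_m p_m drops by η_m, and the term -½ η_m rises by the same amount. -/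
theorem IsSignChange.map_Q₁ {m : Fin n} (h : IsSignChange m s) : s (Q₁ n) = Q₁ n := by
  have hq := gen_ne_zero (Var.q m)
  have key : ∑ j ∈ Finset.univ.erase m, q j * s (p j) =
      ∑ j ∈ Finset.univ.erase m, q j * p j :=
    Finset.sum_congr rfl fun j hj => by rw [h.map_p j (Finset.ne_of_mem_erase hj)]
  have key' : ∑ j ∈ Finset.univ.erase m, s (η j) = ∑ j ∈ Finset.univ.erase m, η j :=
    Finset.sum_congr rfl fun j hj => h.map_eta j (Finset.ne_of_mem_erase hj)
  have e := Q₁_eq (n := n)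
  rw [← Finset.add_sum_erase _ _ (Finset.mem_univ m),
    ← Finset.add_sum_erase _ _ (Finset.mem_univ m)] at e
  rw [e]
  simp only [map_add, map_sum, map_mul, map_sub, map_div₀, map_one, map_ofNat, key, key',
    h.map_eps0, h.map_eps1, h.map_eps2, h.map_eta_self, h.map_q, h.map_p_self]
  field_simp
  ring

theorem IsSignChange.map_Q₂ {m : Fin n} (h : IsSignChange m s) : s (Q₂ n) = Q₂ n := by
  simp only [Q₂, map_sum, map_sub, map_one, h.map_q]

end

/-! ### The relations -/

section

variable {s t : RatField n ≃ₐ[ℂ] RatField n}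

theorem IsS0.mul_self (h : IsS0 s) : s * s = 1 := by
  have h1 := Q₁_ne_zero (n := n)
  have h2 := Q₁_add_ne_zero (n := n)
  have e : s (Q₁ n * (Q₁ n + ε 2)) = Q₁ n * (Q₁ n + ε 2) := by
    rw [map_mul, map_add, h.map_Q₁, h.map_eps2]; ring
  refine algEquiv_ext_gen ?_ ?_ ?_ ?_ ?_ ?_ ?_ <;> intros <;>
    simp only [AlgEquiv.mul_apply, AlgEquiv.one_apply, h.map_eps0, h.map_eps1, h.map_eps2,
      h.map_eta, h.map_x, map_sub, map_one, map_div₀, one_div_one_div]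
  · ring
  · ring
  · rename_i j
    have := gen_ne_zero (Var.p j)
    rw [h.map_q, map_div₀, e, map_mul, map_sub, map_mul, h.map_q_mul_map_p, h.map_eta, h.map_p]
    field_simp
    ring
  · rename_i j
    have := gen_ne_zero (Var.p j)
    rw [h.map_p, map_neg, map_div₀, e, h.map_p]
    field_simp

theorem IsS1.mul_self (h : IsS1 s) : s * s = 1 := by
  refine algEquiv_ext_gen ?_ ?_ ?_ ?_ ?_ ?_ ?_ <;> intros <;>
    simp only [AlgEquiv.mul_apply, AlgEquiv.one_apply, h.map_eps0, h.map_eps1, h.map_eps2,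
      h.map_eta, h.map_x, h.map_q, h.map_p, map_mul, map_one, map_div₀, one_div_one_div]
  all_goals
    rename_i j
    have := gen_ne_zero (Var.x j)
    field_simp

theorem IsS2.mul_self (h : IsS2 s) : s * s = 1 := by
  have h2 := Q₂_ne_zero (n := n)
  refine algEquiv_ext_gen ?_ ?_ ?_ ?_ ?_ ?_ ?_ <;> intros <;>
    simp only [AlgEquiv.mul_apply, AlgEquiv.one_apply, h.map_eps0, h.map_eps1, h.map_eps2,
      h.map_eta, h.map_x, h.map_q, h.map_p, h.map_Q₁, h.map_Q₂, map_mul, map_one, map_div₀,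
      map_sub]
  · field_simp
  · field_simp
    ring
  · rename_i j
    have h3 := x_sub_one_ne_zero j
    have h4 : x j / (x j - 1) - 1 = 1 / (x j - 1) := by field_simp; ring
    rw [h4]
    field_simp

theorem IsS3.mul_self [NeZero n] (h : IsS3 s) : s * s = 1 := by
  have hq := gen_ne_zero (Var.q (0 : Fin n))
  have hx := gen_ne_zero (Var.x (0 : Fin n))
  refine algEquiv_ext_gen ?_ ?_ ?_ ?_ ?_ ?_ ?_
  · simp [h.map_eps0]
  · simp [h.map_eps1]
  · simp [h.map_eps2, h.map_eta_zero]
  all_goals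
    intro j
    rcases eq_or_ne j 0 with rfl | hj
  · simp [h.map_eps2, h.map_eta_zero]
  · simp [h.map_eta j hj]
  · simp [h.map_q_zero]
  · simp only [AlgEquiv.mul_apply, AlgEquiv.one_apply, h.map_q j hj, h.map_q_zero, map_neg,
      map_div₀]
    field_simp
  · simp only [AlgEquiv.mul_apply, AlgEquiv.one_apply, h.map_p_zero, h.map_q_zero, h.map_Q₁,
      map_neg, map_mul]
    field_simp
  · simp only [AlgEquiv.mul_apply, AlgEquiv.one_apply, h.map_p j hj, h.map_q_zero,
      map_neg, map_mul]
    field_simp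
  · simp [h.map_x_zero]
  · simp only [AlgEquiv.mul_apply, AlgEquiv.one_apply, h.map_x j hj, h.map_x_zero,
      map_div₀]
    field_simp

theorem IsPerm.mul {σ τ : Equiv.Perm (Fin n)} (h : IsPerm σ s) (h' : IsPerm τ t) :
    IsPerm (σ * τ) ⇑(s * t) := by
  constructor <;> intros <;>
    simp only [AlgEquiv.mul_apply, Equiv.Perm.mul_apply, h.map_eps0, h.map_eps1, h.map_eps2,
      h.map_eta, h.map_x, h.map_q, h.map_p, h'.map_eps0, h'.map_eps1, h'.map_eps2,
      h'.map_eta, h'.map_x, h'.map_q, h'.map_p]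

theorem isPerm_one : IsPerm 1 ⇑(1 : RatField n ≃ₐ[ℂ] RatField n) := by
  constructor <;> intros <;> rfl

theorem IsPerm.eq {σ : Equiv.Perm (Fin n)} (h : IsPerm σ s) (h' : IsPerm σ t) : s = t := by
  refine algEquiv_ext_gen ?_ ?_ ?_ ?_ ?_ ?_ ?_ <;> intros <;>
    simp only [h.map_eps0, h.map_eps1, h.map_eps2,
      h.map_eta, h.map_x, h.map_q, h.map_p, h'.map_eps0, h'.map_eps1, h'.map_eps2,
      h'.map_eta, h'.map_x, h'.map_q, h'.map_p]

theorem IsSignChange.mul_self {m : Fin n} (h : IsSignChange m s) : s * s = 1 := by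
  have hq := gen_ne_zero (Var.q m)
  refine algEquiv_ext_gen ?_ ?_ ?_ ?_ ?_ ?_ ?_
  · simp [h.map_eps0]
  · simp [h.map_eps1]
  · simp [h.map_eps2]
  all_goals
    intro j
    rcases eq_or_ne j m with rfl | hj
  · simp [h.map_eta_self]
  · simp [h.map_eta j hj]
  · simp [h.map_q]
  · simp [h.map_q]
  · simp only [AlgEquiv.mul_apply, AlgEquiv.one_apply, h.map_p_self, h.map_eta_self, h.map_q,
      map_sub, map_div₀]
    ring
  · simp [h.map_p j hj]
  · simp [h.map_x]
  · simp [h.map_x]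

theorem IsS0.comm_isS1 (h : IsS0 s) (h' : IsS1 t) : s * t = t * s := by
  have h1 := Q₁_ne_zero (n := n)
  have h2 := Q₁_add_ne_zero (n := n)
  refine algEquiv_ext_gen ?_ ?_ ?_ ?_ ?_ ?_ ?_ <;> intros <;>
    simp only [AlgEquiv.mul_apply, h.map_eps0, h.map_eps1, h.map_eps2, h'.map_Q₁,
      h.map_eta, h.map_x, h.map_q, h.map_p, h'.map_eps0, h'.map_eps1, h'.map_eps2, h'.map_eta,
      h'.map_x, h'.map_q, h'.map_p, map_sub, map_add, map_mul, map_div₀, map_neg, map_one]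
  all_goals
    rename_i j
    have := gen_ne_zero (Var.x j)
    have := gen_ne_zero (Var.p j)
    field_simp

theorem IsS0.comm_isS3 [NeZero n] (h : IsS0 s) (h' : IsS3 t) : s * t = t * s := by
  have h1 := Q₁_ne_zero (n := n)
  have h2 := Q₁_add_ne_zero (n := n)
  have hq := gen_ne_zero (Var.q (0 : Fin n))
  have hp := gen_ne_zero (Var.p (0 : Fin n))
  have hx := gen_ne_zero (Var.x (0 : Fin n))
  have hη := mul_sub_eta_ne_zero (0 : Fin n)
  have hη' : η (0 : Fin n) - q 0 * p 0 ≠ 0 := by rw [← neg_sub]; exact neg_ne_zero.2 hη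
  -- The denominator of s₀ is carried by s₃ to the expression governing index 0; this accounts for
  -- the exceptional formulas at `j = 0`.
  have e : t (Q₁ n * (Q₁ n + ε 2)) = q 0 * p 0 * (q 0 * p 0 - η 0) := by
    rw [map_mul, map_add, h'.map_Q₁, h'.map_eps2]; ring
  refine algEquiv_ext_gen ?_ ?_ ?_ ?_ ?_ ?_ ?_
  · simp [h.map_eps0, h'.map_eps0, h'.map_eps1]
  · simp [h.map_eps1, h'.map_eps0, h'.map_eps1]
  · simp [h.map_eps2, h'.map_eps2, h.map_eta]
  all_goals
    intro j
    rcases eq_or_ne j 0 with rfl | hj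
  · simp [h.map_eta, h'.map_eta_zero, h.map_eps2]
  · simp [h.map_eta, h'.map_eta j hj]
  · rw [AlgEquiv.mul_apply, AlgEquiv.mul_apply, h'.map_q_zero, h.map_q, map_div₀, map_div₀, e]
    simp only [map_mul, map_sub, map_one, h'.map_q_zero, h'.map_p_zero, h'.map_eta_zero, h.map_q]
    field_simp
    ring
  · rw [AlgEquiv.mul_apply, AlgEquiv.mul_apply, h'.map_q j hj, h.map_q, map_neg, map_div₀,
      map_div₀, e]
    simp only [map_mul, map_sub, h'.map_q j hj, h'.map_p j hj, h'.map_eta j hj, h.map_q]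
    field_simp
  · rw [AlgEquiv.mul_apply, AlgEquiv.mul_apply, h'.map_p_zero, h.map_p, map_neg, map_neg, map_div₀,
      e]
    simp only [map_mul, h'.map_p_zero, h.map_q, h.map_Q₁]
    field_simp
    ring
  · rw [AlgEquiv.mul_apply, AlgEquiv.mul_apply, h'.map_p j hj, h.map_p, map_neg, map_neg, map_div₀,
      e]
    simp only [map_mul, h'.map_p j hj, h.map_q, h.map_p]
    have := gen_ne_zero (Var.p j)
    field_simp
  · simp [h.map_x, h'.map_x_zero]
  · simp only [AlgEquiv.mul_apply, map_div₀, map_one, h.map_x, h'.map_x j hj]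
    field_simp

theorem IsS0.comm_isPerm {σ : Equiv.Perm (Fin n)} (h : IsS0 s) (h' : IsPerm σ t) :
    s * t = t * s := by
  refine algEquiv_ext_gen ?_ ?_ ?_ ?_ ?_ ?_ ?_ <;> intros <;>
    simp only [AlgEquiv.mul_apply, h.map_eps0, h.map_eps1, h.map_eps2, h'.map_Q₁,
      h.map_eta, h.map_x, h.map_q, h.map_p, h'.map_eps0, h'.map_eps1, h'.map_eps2, h'.map_eta,
      h'.map_x, h'.map_q, h'.map_p, map_sub, map_add, map_mul, map_div₀, map_neg, map_one]

/-- The sign change interchanges q_m p_m and q_m p_m - η_m, whose product divided by q_m is the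
numerator of s₀(q_m). -/
theorem IsS0.comm_isSignChange {m : Fin n} (h : IsS0 s) (h' : IsSignChange m t) :
    s * t = t * s := by
  have h1 := Q₁_ne_zero (n := n)
  have h2 := Q₁_add_ne_zero (n := n)
  have hη := mul_sub_eta_ne_zero m
  have hq := gen_ne_zero (Var.q m)
  have hp := gen_ne_zero (Var.p m)
  refine algEquiv_ext_gen ?_ ?_ ?_ ?_ ?_ ?_ ?_
  · simp [h.map_eps0, h'.map_eps0, h'.map_eps1]
  · simp [h.map_eps1, h'.map_eps0, h'.map_eps1]
  · simp [h.map_eps2, h'.map_eps2]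
  all_goals
    intro j
    rcases eq_or_ne j m with rfl | hj
  · simp [h.map_eta, h'.map_eta_self]
  · simp [h.map_eta, h'.map_eta j hj]
  · simp only [AlgEquiv.mul_apply, h'.map_q, h.map_q, map_div₀, map_mul, map_add, map_sub,
      h'.map_p_self, h'.map_eta_self, h'.map_Q₁, h'.map_eps2]
    field_simp
    ring
  · simp only [AlgEquiv.mul_apply, h'.map_q, h.map_q, map_div₀, map_mul, map_add, map_sub,
      h'.map_p j hj, h'.map_eta j hj, h'.map_Q₁, h'.map_eps2]
  · simp only [AlgEquiv.mul_apply, h.map_p, h.map_eta, h.map_q, map_div₀, map_mul, map_add,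
      map_sub, map_neg, h'.map_p_self, h'.map_Q₁, h'.map_eps2]
    have h3 : p j - η j / q j = (q j * p j - η j) / q j := by field_simp
    rw [h3]
    -- Kept as one symbol, so that its nonvanishing is available when it is a denominator.
    generalize hc : q j * p j - η j = c at *
    field_simp
    rw [← hc]
    ring
  · simp only [AlgEquiv.mul_apply, h.map_p, map_div₀, map_mul, map_add, map_neg,
      h'.map_p j hj, h'.map_Q₁, h'.map_eps2]
  · simp [h.map_x, h'.map_x]
  · simp [h.map_x, h'.map_x]

theorem IsS1.comm_isS3 [NeZero n] (h : IsS1 s) (h' : IsS3 t) : s * t = t * s := by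
  have hq := gen_ne_zero (Var.q (0 : Fin n))
  have hx := gen_ne_zero (Var.x (0 : Fin n))
  refine algEquiv_ext_gen ?_ ?_ ?_ ?_ ?_ ?_ ?_
  · simp [h.map_eps0, h'.map_eps0, h'.map_eps1]
  · simp [h.map_eps1, h'.map_eps0, h'.map_eps1]
  · simp [h.map_eps2, h'.map_eps2, h.map_eta]
  all_goals
    intro j
    rcases eq_or_ne j 0 with rfl | hj
    · simp only [AlgEquiv.mul_apply, h.map_eta, h'.map_eta_zero, h.map_eps2, h'.map_q_zero,
        h.map_q, h.map_x, h.map_p, map_div₀, map_neg, map_mul, map_one, h'.map_x_zero,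
        h'.map_p_zero, h.map_Q₁]
      try field_simp
    · have := gen_ne_zero (Var.x j)
      simp only [AlgEquiv.mul_apply, h.map_eta, h'.map_eta j hj,
        h.map_q, h.map_x, h.map_p, map_div₀, map_neg, map_mul, map_one,
        h'.map_p j hj, h'.map_q j hj, h'.map_x j hj]
      try field_simp

theorem IsS1.comm_isPerm {σ : Equiv.Perm (Fin n)} (h : IsS1 s) (h' : IsPerm σ t) :
    s * t = t * s := by
  refine algEquiv_ext_gen ?_ ?_ ?_ ?_ ?_ ?_ ?_ <;> intros <;>
    simp only [AlgEquiv.mul_apply, h.map_eps0, h.map_eps1, h.map_eps2,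
      h.map_eta, h.map_x, h.map_q, h.map_p, h'.map_eps0, h'.map_eps1, h'.map_eps2, h'.map_eta,
      h'.map_x, h'.map_q, h'.map_p, map_mul, map_div₀, map_one]

theorem IsS1.comm_isSignChange {m : Fin n} (h : IsS1 s) (h' : IsSignChange m t) :
    s * t = t * s := by
  refine algEquiv_ext_gen ?_ ?_ ?_ ?_ ?_ ?_ ?_
  · simp [h.map_eps0, h'.map_eps0, h'.map_eps1]
  · simp [h.map_eps1, h'.map_eps0, h'.map_eps1]
  · simp [h.map_eps2, h'.map_eps2]
  all_goals
    intro j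
    have := gen_ne_zero (Var.x j)
    have := gen_ne_zero (Var.q j)
    rcases eq_or_ne j m with rfl | hj
    · simp only [AlgEquiv.mul_apply, h.map_eta, h'.map_eta_self, h'.map_q,
        h.map_q, h.map_x, h.map_p, map_div₀, map_neg, map_mul, map_one, h'.map_x,
        h'.map_p_self, map_sub]
      try field_simp
    · simp only [AlgEquiv.mul_apply, h.map_eta, h'.map_eta j hj, h'.map_q,
        h.map_q, h.map_x, h.map_p, map_div₀, map_mul, map_one, h'.map_x, h'.map_p j hj]

theorem IsS2.comm_isPerm {σ : Equiv.Perm (Fin n)} (h : IsS2 s) (h' : IsPerm σ t) :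
    s * t = t * s := by
  refine algEquiv_ext_gen ?_ ?_ ?_ ?_ ?_ ?_ ?_ <;> intros <;>
    simp only [AlgEquiv.mul_apply, h.map_eps0, h.map_eps1, h.map_eps2, h'.map_Q₁, h'.map_Q₂,
      h.map_eta, h.map_x, h.map_q, h.map_p, h'.map_eps0, h'.map_eps1, h'.map_eps2, h'.map_eta,
      h'.map_x, h'.map_q, h'.map_p, map_mul, map_div₀, map_one, map_sub]

theorem IsS2.comm_isSignChange {m : Fin n} (h : IsS2 s) (h' : IsSignChange m t) :
    s * t = t * s := by
  have h2 := Q₂_ne_zero (n := n)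
  refine algEquiv_ext_gen ?_ ?_ ?_ ?_ ?_ ?_ ?_
  · simp [h.map_eps0, h'.map_eps0]
  · simp [h.map_eps1, h'.map_eps2, h'.map_eps1]
  · simp [h.map_eps2, h'.map_eps2, h'.map_eps1]
  all_goals
    intro j
    have := gen_ne_zero (Var.q j)
    rcases eq_or_ne j m with rfl | hj
    · simp only [AlgEquiv.mul_apply, h.map_eta, h'.map_eta_self, h'.map_q, h'.map_Q₁, h'.map_Q₂,
        h.map_q, h.map_x, h.map_p, map_div₀, map_neg, map_mul, map_one, h'.map_x,
        h'.map_p_self, map_sub]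
      try (field_simp; ring)
    · simp only [AlgEquiv.mul_apply, h.map_eta, h'.map_eta j hj, h'.map_q, h'.map_Q₁, h'.map_Q₂,
        h.map_q, h.map_x, h.map_p, map_div₀, map_mul, map_one, h'.map_x, h'.map_p j hj, map_sub]

theorem IsS3.comm_isPerm [NeZero n] {σ : Equiv.Perm (Fin n)} (hσ : σ 0 = 0) (h : IsS3 s)
    (h' : IsPerm σ t) : s * t = t * s := by
  refine algEquiv_ext_gen ?_ ?_ ?_ ?_ ?_ ?_ ?_
  · simp [h.map_eps0, h'.map_eps0]
  · simp [h.map_eps1, h'.map_eps1]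
  · simp [h.map_eps2, h'.map_eps2, h'.map_eta, hσ]
  all_goals
    intro j
    rcases eq_or_ne j 0 with rfl | hj
    · simp only [AlgEquiv.mul_apply, h'.map_eta, hσ, h.map_eta_zero, h'.map_eps2, h.map_q_zero,
        h'.map_q, h'.map_p, h'.map_x, h'.map_Q₁, h.map_p_zero, h.map_x_zero, map_div₀, map_neg,
        map_mul, map_one]
    · have hj' : σ j ≠ 0 := fun e => hj (σ.injective (e.trans hσ.symm))
      simp only [AlgEquiv.mul_apply, h'.map_eta, h.map_eta j hj, h.map_eta _ hj', h'.map_q,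
        h'.map_p, h'.map_x, h.map_q j hj, h.map_q _ hj', h.map_p j hj, h.map_p _ hj',
        h.map_x j hj, h.map_x _ hj', hσ, map_neg, map_mul, map_div₀]

theorem IsS3.comm_isSignChange [NeZero n] {m : Fin n} (hm : m ≠ 0) (h : IsS3 s)
    (h' : IsSignChange m t) : s * t = t * s := by
  have hq := gen_ne_zero (Var.q (0 : Fin n))
  have hqm := gen_ne_zero (Var.q m)
  refine algEquiv_ext_gen ?_ ?_ ?_ ?_ ?_ ?_ ?_
  · simp [h.map_eps0, h'.map_eps0]
  · simp [h.map_eps1, h'.map_eps1]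
  · simp [h.map_eps2, h'.map_eps2, h'.map_eta 0 hm.symm]
  all_goals
    intro j
    rcases eq_or_ne j 0 with rfl | hj
    · simp only [AlgEquiv.mul_apply, h'.map_eta _ hm.symm, h.map_eta_zero, h'.map_eps2,
        h.map_q_zero, h'.map_q, h'.map_p _ hm.symm, h'.map_x, h'.map_Q₁, h.map_p_zero,
        h.map_x_zero, map_div₀, map_neg, map_mul, map_one]
    rcases eq_or_ne j m with rfl | hjm
    · simp only [AlgEquiv.mul_apply, h'.map_eta_self, h.map_eta _ hj, h'.map_q, h'.map_p_self,
        h'.map_x, h.map_q _ hj, h.map_p _ hj, h.map_x _ hj, map_neg, map_mul, map_div₀, map_sub]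
      try (field_simp; try ring)
    · simp only [AlgEquiv.mul_apply, h'.map_eta _ hjm, h.map_eta _ hj, h'.map_q, h'.map_p _ hjm,
        h'.map_x, h.map_q _ hj, h.map_p _ hj, h.map_x _ hj, map_neg, map_mul, map_div₀]

theorem IsPerm.comm_isSignChange {σ : Equiv.Perm (Fin n)} {m : Fin n} (hσ : σ m = m)
    (h : IsPerm σ s) (h' : IsSignChange m t) : s * t = t * s := by
  refine algEquiv_ext_gen ?_ ?_ ?_ ?_ ?_ ?_ ?_
  · simp [h.map_eps0, h'.map_eps0]
  · simp [h.map_eps1, h'.map_eps1]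
  · simp [h.map_eps2, h'.map_eps2]
  all_goals
    intro j
    rcases eq_or_ne j m with rfl | hj
    · simp only [AlgEquiv.mul_apply, h.map_eta, h'.map_eta_self, h'.map_q, hσ,
        h.map_q, h'.map_p_self, h.map_p, h.map_x, h'.map_x, map_neg, map_sub, map_div₀]
    · have hj' : σ j ≠ m := fun e => hj (σ.injective (e.trans hσ.symm))
      simp only [AlgEquiv.mul_apply, h.map_eta, h'.map_eta j hj, h'.map_eta _ hj', h'.map_q,
        h.map_q, h'.map_p j hj, h.map_p, h'.map_p _ hj', h.map_x, h'.map_x]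

/-- Conjugates of sign changes by permutations are sign changes. -/
theorem IsPerm.conj_isSignChange {σ : Equiv.Perm (Fin n)} {m : Fin n} (hσ : ∀ j, σ (σ j) = j)
    (h : IsPerm σ s) (h' : IsSignChange m t) : IsSignChange (σ m) ⇑(s * t * s) := by
  have hne : ∀ j, j ≠ σ m → σ j ≠ m := fun j hj e => hj (by rw [← e, hσ])
  constructor
  · simp [h.map_eps0, h'.map_eps0]
  · simp [h.map_eps1, h'.map_eps1]
  · simp [h.map_eps2, h'.map_eps2]
  · simp only [AlgEquiv.mul_apply, h.map_eta, hσ, h'.map_eta_self, map_neg]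
  · intro j hj
    simp only [AlgEquiv.mul_apply, h.map_eta, hσ, h'.map_eta _ (hne j hj)]
  · intro j
    simp only [AlgEquiv.mul_apply, h.map_q, hσ, h'.map_q]
  · simp only [AlgEquiv.mul_apply, h.map_p, hσ, h'.map_p_self, map_sub, map_div₀, h.map_eta,
      h.map_q]
  · intro j hj
    simp only [AlgEquiv.mul_apply, h.map_p, hσ, h'.map_p _ (hne j hj)]
  · intro j
    simp only [AlgEquiv.mul_apply, h.map_x, hσ, h'.map_x]

theorem IsSignChange.comm {m m' : Fin n} (hm : m ≠ m') (h : IsSignChange m s)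
    (h' : IsSignChange m' t) : s * t = t * s := by
  refine algEquiv_ext_gen ?_ ?_ ?_ ?_ ?_ ?_ ?_
  · simp [h.map_eps0, h'.map_eps0]
  · simp [h.map_eps1, h'.map_eps1]
  · simp [h.map_eps2, h'.map_eps2]
  all_goals
    intro j
    rcases eq_or_ne j m with rfl | hj
    · simp only [AlgEquiv.mul_apply, h'.map_eta j hm, h.map_eta_self, h'.map_q,
        h.map_q, h'.map_p j hm, h.map_p_self, h.map_x, h'.map_x,
        map_neg, map_sub, map_div₀]
    rcases eq_or_ne j m' with rfl | hj'
    · simp only [AlgEquiv.mul_apply, h.map_eta j hj, h'.map_eta_self, h'.map_q,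
        h.map_q, h.map_p j hj, h'.map_p_self, h.map_x, h'.map_x,
        map_neg, map_sub, map_div₀]
    · simp only [AlgEquiv.mul_apply, h.map_eta j hj, h'.map_eta j hj', h'.map_q,
        h.map_q, h.map_p j hj, h'.map_p j hj', h.map_x, h'.map_x]

end

/-! ### Braid relations, and the conjugate of a sign change by s₃. -/

section

variable {s t : RatField n ≃ₐ[ℂ] RatField n}

theorem IsS0.braid_isS2 (h : IsS0 s) (h' : IsS2 t) : s * t * s = t * s * t := by
  have h1 := Q₁_ne_zero (n := n)
  have h2 := Q₁_add_ne_zero (n := n)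
  have hQ₂ := Q₂_ne_zero (n := n)
  -- Nonvanishing is transferred through the injective maps `s` and `t`, here and for `R` and `S`
  -- below.
  have hQ₃ : Q₃ n ≠ 0 := fun e => mul_ne_zero (mul_ne_zero h1 h2) hQ₂ (by
    rw [← h.map_Q₃, e, map_zero])
  obtain ⟨R, hR⟩ : ∃ R, R = Q₃ n + Q₁ n * (1 - ε 0) := ⟨_, rfl⟩
  have hR0 : R ≠ 0 := by
    have : t (Q₃ n) ≠ 0 := (map_ne_zero t).2 hQ₃
    rw [h'.map_Q₃, ← hR] at this
    exact right_ne_zero_of_mul this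
  have htQ₃ : t (Q₃ n) = Q₂ n * R := by rw [h'.map_Q₃, hR]
  -- `R` and `S` are the new factors in t(Q₃) and t(Q₁(Q₁ + ε₂)). Since s(S) = -R/Q₁, both triple
  -- products can be written with these factors, treated as opaque symbols.
  obtain ⟨S, hS⟩ : ∃ S, S = Q₁ n * Q₂ n - ε 1 := ⟨_, rfl⟩
  have htg : t (Q₁ n * (Q₁ n + ε 2)) = Q₁ n * Q₂ n * S := by
    rw [map_mul, map_add, h'.map_Q₁, h'.map_eps2, hS]; ring
  have hS0 : S ≠ 0 := by
    have : t (Q₁ n * (Q₁ n + ε 2)) ≠ 0 := (map_ne_zero t).2 (mul_ne_zero h1 h2)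
    rw [htg] at this
    exact right_ne_zero_of_mul this
  have hsS : s S = -(R / Q₁ n) := by
    rw [hS, map_sub, map_mul, h.map_Q₁, h.map_Q₂, h.map_eps1, hR]
    field_simp
    ring
  refine algEquiv_ext_gen ?_ ?_ ?_ ?_ ?_ ?_ ?_
  · simp [h.map_eps0, h'.map_eps0, h'.map_eps1, h.map_eps2]
  · simp [h.map_eps1, h'.map_eps0, h'.map_eps1, h.map_eps2, h'.map_eps2, h.map_eps0]
  · simp [h.map_eps2, h'.map_eps2, h.map_eps1, h'.map_eps0]
  · simp [h.map_eta, h'.map_eta]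
  · intro j
    have hp := gen_ne_zero (Var.p j)
    have hts : t (s (q j)) = (p j - Q₁ n) * (q j * (p j - Q₁ n) - η j) / (Q₁ n * S) := by
      rw [h.map_q, map_div₀, htg]
      simp only [map_mul, map_sub, h'.map_p, h'.map_q, h'.map_eta]
      field_simp
    have hst : s (t (q j)) = p j * (q j * p j - η j) / Q₃ n := by
      rw [h'.map_q, map_div₀, h.map_q, h.map_Q₂]
      field_simp
    rw [AlgEquiv.mul_apply, AlgEquiv.mul_apply, AlgEquiv.mul_apply, AlgEquiv.mul_apply, hts, hst]
    simp only [map_div₀, map_mul, map_sub, htQ₃, hsS, h.map_p, h.map_q, h.map_eta, h.map_Q₁,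
      h'.map_q, h'.map_p, h'.map_eta]
    have h3 : -Q₁ n - ε 2 = -(Q₁ n + ε 2) := by ring
    rw [h3]
    field_simp
    ring
  · intro j
    have hp := gen_ne_zero (Var.p j)
    have hpQ : p j - Q₁ n ≠ 0 := by
      have : t (p j) ≠ 0 := (map_ne_zero t).2 hp
      rw [h'.map_p] at this
      exact left_ne_zero_of_mul this
    have hsp : s (p j) - s (Q₁ n) = (Q₁ n + ε 2) * (p j - Q₁ n) / p j := by
      rw [h.map_p, h.map_Q₁]
      field_simp
      ring
    have htp : t (p j) - t (Q₁ n) = p j * Q₂ n := by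
      rw [h'.map_p, h'.map_Q₁]
      ring
    have hts : t (s (p j)) = -(Q₁ n * S / (p j - Q₁ n)) := by
      rw [h.map_p, map_neg, map_div₀, htg, h'.map_p]
      field_simp
    have hst : s (t (p j)) = (p j - Q₁ n) * Q₃ n / (p j * Q₁ n) := by
      rw [h'.map_p, map_mul, map_sub, hsp, h.map_Q₂]
      field_simp
    rw [AlgEquiv.mul_apply, AlgEquiv.mul_apply, AlgEquiv.mul_apply, AlgEquiv.mul_apply, hts, hst]
    simp only [map_div₀, map_mul, map_sub, map_neg, htQ₃, hsS, hsp, htp]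
    rw [h.map_Q₁, h'.map_Q₁, h'.map_p]
    have h3 : -Q₁ n - ε 2 = -(Q₁ n + ε 2) := by ring
    rw [h3]
    field_simp
  · intro j
    have hx := gen_ne_zero (Var.x j)
    have hx1 := x_sub_one_ne_zero j
    have hst : s (t (x j)) = -(1 / (x j - 1)) := by
      have h3 : 1 / x j - 1 = -((x j - 1) / x j) := by field_simp; ring
      rw [h'.map_x, map_div₀, map_sub, map_one, h.map_x, h3]
      field_simp
    have h4 : x j / (x j - 1) - 1 = 1 / (x j - 1) := by field_simp; ring
    rw [AlgEquiv.mul_apply, AlgEquiv.mul_apply, AlgEquiv.mul_apply, AlgEquiv.mul_apply, hst]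
    simp only [map_div₀, map_sub, map_neg, map_one, h.map_x, h'.map_x, h4]
    field_simp
    ring

/-- On each `x j`, s₁ and s₂ act by the Möbius maps exchanging 0, ∞ and 1, ∞, two overlapping
transpositions. On `q` and `p` the only denominators beyond the variables and `x j - 1` are `Q₂` and
its image `Q₄`. -/
theorem IsS1.braid_isS2 (h : IsS1 s) (h' : IsS2 t) : s * t * s = t * s * t := by
  have hQ₂ := Q₂_ne_zero (n := n)
  have hQ₄ : Q₄ n ≠ 0 := by
    rw [← h.map_Q₂]
    exact (map_ne_zero s).2 hQ₂
  refine algEquiv_ext_gen ?_ ?_ ?_ ?_ ?_ ?_ ?_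
  · simp [h.map_eps0, h'.map_eps0, h'.map_eps1, h.map_eps2]
  · simp [h.map_eps1, h'.map_eps0, h'.map_eps1, h.map_eps2, h'.map_eps2, h.map_eps0]
  · simp [h.map_eps2, h'.map_eps2, h.map_eps1, h'.map_eps0]
  · simp [h.map_eta, h'.map_eta]
  all_goals
    intro j
    have hx := gen_ne_zero (Var.x j)
    have hx1 := x_sub_one_ne_zero j
    have h3 : 1 / x j - 1 = -((x j - 1) / x j) := by field_simp; ring
    simp only [AlgEquiv.mul_apply, map_div₀, map_mul, map_sub, map_one, h.map_q, h'.map_q,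
      h.map_p, h'.map_p, h.map_x, h'.map_x, h.map_Q₁, h'.map_Q₁, h.map_Q₂,
      h'.map_Q₄, h3]
  · field_simp
  · field_simp
    ring
  · have h5 : 1 / (x j / (x j - 1)) - 1 = -(1 / x j) := by field_simp; ring
    rw [h5]
    field_simp

/-- On `q`, both maps permute the homogeneous coordinates (-Q₂ : -1 : q₀ : q₁ : …), which sum to
zero: s₂ exchanges the first two and s₃ the second and third. -/
theorem IsS2.braid_isS3 [NeZero n] (h : IsS2 s) (h' : IsS3 t) : s * t * s = t * s * t := by
  have hQ₂ := Q₂_ne_zero (n := n)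
  have hq := gen_ne_zero (Var.q (0 : Fin n))
  have hx := gen_ne_zero (Var.x (0 : Fin n))
  have hx1 := x_sub_one_ne_zero (0 : Fin n)
  refine algEquiv_ext_gen ?_ ?_ ?_ ?_ ?_ ?_ ?_
  · simp [h.map_eps0, h'.map_eps0]
  · simp [h.map_eps1, h'.map_eps1, h.map_eta, h'.map_eps2]
  · simp [h.map_eps2, h'.map_eps2, h.map_eps1, h'.map_eps1, h.map_eta, h'.map_eta_zero]
  all_goals
    intro j
    rcases eq_or_ne j 0 with rfl | hj
  · simp [h.map_eps2, h.map_eta, h'.map_eta_zero, h'.map_eps1]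
  · simp [h.map_eta, h'.map_eta j hj]
  · simp only [AlgEquiv.mul_apply, map_div₀, map_neg, map_one, h.map_q, h'.map_q_zero, h.map_Q₂,
      h'.map_Q₂]
    field_simp
  · simp only [AlgEquiv.mul_apply, map_div₀, map_neg, h.map_q, h'.map_q j hj,
      h'.map_q_zero, h.map_Q₂, h'.map_Q₂]
    field_simp
  · simp only [AlgEquiv.mul_apply, map_div₀, map_neg, map_mul, map_sub, h.map_p,
      h'.map_p_zero, h.map_q, h'.map_q_zero, h.map_Q₂, h'.map_Q₂, h.map_Q₁, h'.map_Q₁]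
    field_simp
    ring
  · simp only [AlgEquiv.mul_apply, map_div₀, map_neg, map_mul, map_sub, h.map_p,
      h'.map_p j hj, h.map_q, h'.map_q_zero, h.map_Q₂, h'.map_Q₂, h'.map_Q₁]
    field_simp
    ring
  all_goals
    have h3 : 1 / x (0 : Fin n) - 1 = -((x 0 - 1) / x 0) := by field_simp; ring
  · have h5 : 1 / (x (0 : Fin n) / (x 0 - 1)) - 1 = -(1 / x 0) := by field_simp; ring
    simp only [AlgEquiv.mul_apply, map_div₀, map_one, map_sub, h.map_x, h'.map_x_zero, h3, h5]
    field_simp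
  · have hxj := gen_ne_zero (Var.x j)
    have hxj1 := x_sub_one_ne_zero j
    -- Applying s₂ to x_j/x₀ produces the denominator x_j/x₀ - 1, hence the need for x_j ≠ x₀.
    have hxx := x_sub_x_ne_zero hj
    have h6 : x j / x 0 - 1 = (x j - x 0) / x 0 := by field_simp
    have h7 : x j / (x j - 1) / (x 0 / (x 0 - 1)) - 1 = -((x j - x 0) / ((x j - 1) * x 0)) := by
      field_simp
      ring
    simp only [AlgEquiv.mul_apply, map_div₀, map_one, map_sub, h.map_x, h'.map_x_zero,
      h'.map_x j hj, h3, h6, h7]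
    field_simp

/-- s₃ exchanges the first two homogeneous coordinates of (-1 : q₀ : …) and of (1 : x₀ : …), and `ε
2` with `η 0`; the swap of 0 and `m` is a transposition overlapping it in one place. -/
theorem IsS3.braid_isPerm [NeZero n] {m : Fin n} (hm : m ≠ 0) (h : IsS3 s)
    (h' : IsPerm (Equiv.swap 0 m) t) : s * t * s = t * s * t := by
  have hq := gen_ne_zero (Var.q (0 : Fin n))
  have hqm := gen_ne_zero (Var.q m)
  have hx := gen_ne_zero (Var.x (0 : Fin n))
  have hxm := gen_ne_zero (Var.x m)
  have h0 : Equiv.swap 0 m 0 = m := Equiv.swap_apply_left _ _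
  have h1 : Equiv.swap 0 m m = 0 := Equiv.swap_apply_right _ _
  refine algEquiv_ext_gen ?_ ?_ ?_ ?_ ?_ ?_ ?_
  · simp [h.map_eps0, h'.map_eps0]
  · simp [h.map_eps1, h'.map_eps1]
  · simp only [AlgEquiv.mul_apply, h.map_eps2, h'.map_eta, h0, h.map_eta m hm, h'.map_eps2]
  all_goals
    intro j
    rcases eq_or_ne j 0 with rfl | hj
    · simp only [AlgEquiv.mul_apply, h.map_eta_zero, h'.map_eta, h.map_eps2, h0, h.map_eta m hm,
        h'.map_eps2, h1, map_div₀, map_neg, map_mul, map_one, h.map_q_zero, h.map_q m hm,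
        h'.map_q, h.map_p_zero, h.map_p m hm, h'.map_p, h.map_x_zero, h.map_x m hm, h'.map_x,
        h.map_Q₁, h'.map_Q₁]
      try (field_simp; try ring)
    rcases eq_or_ne j m with rfl | hjm
    · simp only [AlgEquiv.mul_apply, h.map_eta_zero, h'.map_eta, h0, h.map_eta _ hm,
        h'.map_eps2, h1, map_div₀, map_neg, map_mul, map_one, h.map_q_zero, h.map_q _ hm,
        h'.map_q, h.map_p_zero, h.map_p _ hm, h'.map_p, h.map_x_zero, h.map_x _ hm, h'.map_x,
        h'.map_Q₁]
      try (field_simp; try ring)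
    · have h2 : Equiv.swap 0 m j = j := Equiv.swap_apply_of_ne_of_ne hj hjm
      simp only [AlgEquiv.mul_apply, h'.map_eta, h0, h2, h.map_eta _ hj, map_div₀, map_neg,
        map_mul, h.map_q _ hj, h.map_q _ hm,
        h'.map_q, h.map_p _ hj, h'.map_p, h.map_x _ hj, h.map_x _ hm, h'.map_x]
      try (field_simp; try ring)

/-- The transformation that changes the sign of `ε₃`. -/
structure IsEpsSignChange (s : RatField n → RatField n) : Prop where
  map_eps0 : s (ε 0) = ε 0
  map_eps1 : s (ε 1) = ε 1
  map_eps2 : s (ε 2) = -ε 2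
  map_eta : ∀ j, s (η j) = η j
  map_q : ∀ j, s (q j) = q j
  map_p : ∀ j, s (p j) = p j
  map_x : ∀ j, s (x j) = x j

theorem IsEpsSignChange.comm_isSignChange {m : Fin n} (h : IsEpsSignChange s)
    (h' : IsSignChange m t) : s * t = t * s := by
  refine algEquiv_ext_gen ?_ ?_ ?_ ?_ ?_ ?_ ?_
  · simp [h.map_eps0, h'.map_eps0]
  · simp [h.map_eps1, h'.map_eps1]
  · simp [h.map_eps2, h'.map_eps2]
  all_goals
    intro j
    rcases eq_or_ne j m with rfl | hj
    · simp only [AlgEquiv.mul_apply, h.map_eta, h'.map_eta_self, h'.map_q,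
        h.map_q, h'.map_p_self, h.map_p, h.map_x, h'.map_x, map_neg, map_sub, map_div₀]
    · simp only [AlgEquiv.mul_apply, h.map_eta, h'.map_eta j hj, h'.map_q,
        h.map_q, h'.map_p j hj, h.map_p, h.map_x, h'.map_x]

/-- The conjugate of a sign change by `s₃`. -/
theorem IsS3.conj_isSignChange [NeZero n] (h : IsS3 s) (h' : IsSignChange 0 t) :
    IsEpsSignChange ⇑(s * t * s) := by
  have hq := gen_ne_zero (Var.q (0 : Fin n))
  have hx := gen_ne_zero (Var.x (0 : Fin n))
  constructor
  · simp [h.map_eps0, h'.map_eps0]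
  · simp [h.map_eps1, h'.map_eps1]
  · simp [h.map_eps2, h'.map_eta_self, h.map_eta_zero]
  all_goals
    intro j
    rcases eq_or_ne j 0 with rfl | hj
  · simp [h.map_eps2, h.map_eta_zero, h'.map_eps2]
  · simp [h.map_eta j hj, h'.map_eta j hj]
  · simp [h.map_q_zero, h'.map_q]
  · simp only [AlgEquiv.mul_apply, h.map_q j hj, h.map_q_zero, h'.map_q, map_neg, map_div₀]
    field_simp
  · simp only [AlgEquiv.mul_apply, h.map_p_zero, h.map_q_zero, h'.map_q, h.map_Q₁, h'.map_Q₁,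
      map_neg, map_mul]
    field_simp
  · simp only [AlgEquiv.mul_apply, h.map_p j hj, h'.map_p j hj, h.map_q_zero, h'.map_q,
      map_neg, map_mul]
    field_simp
  · simp [h.map_x_zero, h'.map_x]
  · simp only [AlgEquiv.mul_apply, h.map_x j hj, h.map_x_zero, h'.map_x, map_div₀]
    field_simp

end

/-! ### Relations between involutions in a group -/

section

variable {G : Type*} [Group G] {a b : G}

theorem mul_sq_eq_one_of_comm (ha : a * a = 1) (hb : b * b = 1) (h : a * b = b * a) :
    (a * b) ^ 2 = 1 := by
  rw [pow_two]
  nth_rewrite 2 [h]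
  rw [mul_assoc, ← mul_assoc b, hb, one_mul, ha]

theorem mul_pow_three_eq_one_of_braid (ha : a * a = 1) (hb : b * b = 1)
    (h : a * b * a = b * a * b) : (a * b) ^ 3 = 1 := by
  have e : (a * b) ^ 3 = a * b * a * (b * a * b) := by simp only [pow_succ, pow_zero]; group
  rw [e, ← h]
  calc a * b * a * (a * b * a) = a * b * (a * a) * b * a := by group
    _ = a * (b * b) * a := by rw [ha]; group
    _ = 1 := by rw [hb, mul_one, ha]

/-- The conjugate aba is again an involution, and (ab)⁴ = ((aba)b)² is trivial when aba commutes
with b. -/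
theorem mul_pow_four_eq_one_of_comm (ha : a * a = 1) (hb : b * b = 1)
    (h : a * b * a * b = b * (a * b * a)) : (a * b) ^ 4 = 1 := by
  have hc : a * b * a * (a * b * a) = 1 := by
    calc a * b * a * (a * b * a) = a * b * (a * a) * b * a := by group
      _ = a * (b * b) * a := by rw [ha]; group
      _ = 1 := by rw [hb, mul_one, ha]
  have e : (a * b) ^ 4 = (a * b * a * b) ^ 2 := by simp only [pow_succ, pow_zero]; group
  rw [e]
  exact mul_sq_eq_one_of_comm hc hb h

end

/-! ### Canonicity -/

section

variable {s : RatField n ≃ₐ[ℂ] RatField n}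

theorem isCanonical_of_eta (h0 : ∀ g, poisson (s (ε 0)) g = 0) (h1 : ∀ g, poisson (s (ε 1)) g = 0)
    (h2 : ∀ g, poisson (s (ε 2)) g = 0) (hη : ∀ j g, poisson (s (η j)) g = 0)
    (hx : ∀ j g, poisson (s (x j)) g = 0)
    (hqq : ∀ i j, poisson (s (q i)) (s (q j)) = 0) (hpp : ∀ i j, poisson (s (p i)) (s (p j)) = 0)
    (hpq : ∀ i j, poisson (s (p i)) (s (q j)) = if i = j then 1 else 0) : IsCanonical s :=
  isCanonical_of_forall (fun j => Fin.cases h0 (Fin.cases h1 (Fin.cases h2 hη)) j) hx hqq hpp hpq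

theorem IsS0.isCanonical (h : IsS0 s) : IsCanonical s := by
  have h1 := Q₁_ne_zero (n := n)
  have h2 := Q₁_add_ne_zero (n := n)
  refine isCanonical_of_eta ?_ ?_ ?_ ?_ ?_ ?_ ?_ ?_ <;> intros <;>
    simp only [h.map_eps0, h.map_eps1, h.map_eps2, h.map_eta, h.map_x, h.map_q, h.map_p,
      poisson_sub_left, poisson_one_left, poisson_eps_left, poisson_x_left, poisson_div_left,
      poisson_div_right, poisson_mul_left, poisson_mul_right, poisson_add_left,
      poisson_add_right, poisson_neg_left, poisson_neg_right, poisson_sub_right,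
      poisson_eps_right, poisson_self, poisson_Q₁_q, poisson_Q₁_p, poisson_q_Q₁, poisson_p_Q₁,
      poisson_q_q, poisson_p_p]
  · simp
  · simp
  · simp
  · rename_i i j
    rcases eq_or_ne i j with rfl | hij
    · simp only [poisson_q_p, poisson_p_q, if_true]
      field_simp
      ring
    · simp only [poisson_q_p, poisson_p_q, if_neg hij]
      field_simp
      ring
  · rename_i i j
    have := gen_ne_zero (Var.p i)
    have := gen_ne_zero (Var.p j)
    field_simp
    ring
  · rename_i i j
    have := gen_ne_zero (Var.p i)
    have := gen_ne_zero (Var.p j)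
    rcases eq_or_ne i j with rfl | hij
    · simp only [poisson_p_q, if_true]
      field_simp
      ring
    · simp only [poisson_p_q, if_neg hij]
      field_simp
      ring

theorem IsS1.isCanonical (h : IsS1 s) : IsCanonical s := by
  refine isCanonical_of_eta ?_ ?_ ?_ ?_ ?_ ?_ ?_ ?_ <;> intros <;>
    simp only [h.map_eps0, h.map_eps1, h.map_eps2, h.map_eta, h.map_x, h.map_q, h.map_p,
      poisson_one_left, poisson_eps_left, poisson_x_left, poisson_x_right, poisson_div_left,
      poisson_div_right, poisson_mul_left, poisson_mul_right, poisson_q_q, poisson_p_p,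
      poisson_p_q]
  · simp
  · simp
  · simp
  · rename_i i j
    have := gen_ne_zero (Var.x i)
    have := gen_ne_zero (Var.x j)
    rcases eq_or_ne i j with rfl | hij
    · simp only [if_true]
      field_simp
      ring
    · simp only [if_neg hij]
      ring

theorem IsS2.isCanonical (h : IsS2 s) : IsCanonical s := by
  have h2 := Q₂_ne_zero (n := n)
  refine isCanonical_of_eta ?_ ?_ ?_ ?_ ?_ ?_ ?_ ?_ <;> intros <;>
    simp only [h.map_eps0, h.map_eps1, h.map_eps2, h.map_eta, h.map_x, h.map_q, h.map_p,
      poisson_sub_left, poisson_one_left, poisson_eps_left, poisson_x_left, poisson_div_left,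
      poisson_div_right, poisson_mul_left, poisson_mul_right, poisson_sub_right,
      poisson_self, poisson_Q₁_q, poisson_Q₁_p, poisson_p_Q₁, poisson_Q₂_q,
      poisson_Q₂_p, poisson_q_Q₂, poisson_p_Q₂, poisson_Q₁_Q₂, poisson_Q₂_Q₁,
      poisson_q_q, poisson_p_p]
  · simp
  · simp
  · ring
  · rename_i i j
    rcases eq_or_ne i j with rfl | hij
    · simp only [poisson_p_q, if_true]
      field_simp
      ring
    · simp only [poisson_p_q, if_neg hij]
      field_simp
      ring

theorem IsS3.isCanonical [NeZero n] (h : IsS3 s) : IsCanonical s := by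
  have hq := gen_ne_zero (Var.q (0 : Fin n))
  have hx := gen_ne_zero (Var.x (0 : Fin n))
  refine isCanonical_of_eta ?_ ?_ ?_ ?_ ?_ ?_ ?_ ?_
  · intro; rw [h.map_eps0, poisson_eps_left]
  · intro; rw [h.map_eps1, poisson_eps_left]
  · intro; rw [h.map_eps2, poisson_eps_left]
  · intro j _
    rcases eq_or_ne j 0 with rfl | hj
    · rw [h.map_eta_zero, poisson_eps_left]
    · rw [h.map_eta j hj, poisson_eps_left]
  · intro j _
    rcases eq_or_ne j 0 with rfl | hj
    · simp [-one_div, h.map_x_zero, poisson_div_left, poisson_one_left, poisson_x_left]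
    · simp [h.map_x j hj, poisson_div_left, poisson_x_left]
  all_goals
    intro i j
    rcases eq_or_ne i 0 with rfl | hi <;> rcases eq_or_ne j 0 with rfl | hj
  · exact poisson_self _
  · simp [-one_div, h.map_q_zero, h.map_q j hj, poisson_div_left, poisson_div_right,
      poisson_neg_right, poisson_one_left, poisson_q_q]
  · simp [-one_div, h.map_q_zero, h.map_q i hi, poisson_div_left, poisson_div_right,
      poisson_neg_left, poisson_one_right, poisson_q_q]
  · simp [h.map_q i hi, h.map_q j hj, poisson_div_left, poisson_div_right, poisson_neg_left,
      poisson_neg_right, poisson_q_q]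
  · exact poisson_self _
  · simp only [h.map_p_zero, h.map_p j hj, poisson_neg_left, poisson_neg_right, poisson_mul_left,
      poisson_mul_right, poisson_Q₁_q, poisson_Q₁_p, poisson_q_q, poisson_q_p, if_neg hj.symm]
    ring
  · simp only [h.map_p_zero, h.map_p i hi, poisson_neg_left, poisson_neg_right, poisson_mul_left,
      poisson_mul_right, poisson_q_Q₁, poisson_p_Q₁, poisson_q_q, poisson_p_q, if_neg hi]
    ring
  · simp only [h.map_p i hi, h.map_p j hj, poisson_neg_left, poisson_neg_right, poisson_mul_left,
      poisson_mul_right, poisson_q_q, poisson_p_q, poisson_q_p, poisson_p_p, if_neg hi,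
      if_neg hj.symm]
    ring
  · simp only [h.map_p_zero, h.map_q_zero, poisson_neg_left, poisson_mul_left, poisson_div_right,
      poisson_one_right, poisson_Q₁_q, poisson_q_q, if_true]
    field_simp
    ring
  · simp only [h.map_p_zero, h.map_q j hj, poisson_neg_left, poisson_neg_right, poisson_mul_left,
      poisson_div_right, poisson_Q₁_q, poisson_q_q, if_neg hj.symm]
    field_simp
    ring
  · simp only [h.map_p i hi, h.map_q_zero, poisson_neg_left, poisson_mul_left, poisson_div_right,
      poisson_one_right, poisson_p_q, poisson_q_q, if_neg hi]
    ring
  · simp only [h.map_p i hi, h.map_q j hj, poisson_neg_left, poisson_neg_right, poisson_mul_left,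
      poisson_div_right, poisson_p_q, poisson_q_q, if_neg hi]
    rcases eq_or_ne i j with rfl | hij
    · simp only [if_true]
      field_simp
      ring
    · simp only [if_neg hij]
      ring

theorem IsPerm.isCanonical {σ : Equiv.Perm (Fin n)} (h : IsPerm σ s) : IsCanonical s := by
  refine isCanonical_of_eta ?_ ?_ ?_ ?_ ?_ ?_ ?_ ?_ <;> intros <;>
    simp only [h.map_eps0, h.map_eps1, h.map_eps2, h.map_eta, h.map_x, h.map_q, h.map_p,
      poisson_eps_left, poisson_x_left, poisson_q_q, poisson_p_p, poisson_p_q,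
      EmbeddingLike.apply_eq_iff_eq]

theorem IsSignChange.isCanonical {m : Fin n} (h : IsSignChange m s) : IsCanonical s := by
  have hq := gen_ne_zero (Var.q m)
  refine isCanonical_of_eta ?_ ?_ ?_ ?_ ?_ ?_ ?_ ?_
  · intro; rw [h.map_eps0, poisson_eps_left]
  · intro; rw [h.map_eps1, poisson_eps_left]
  · intro; rw [h.map_eps2, poisson_eps_left]
  · intro j _
    rcases eq_or_ne j m with rfl | hj
    · rw [h.map_eta_self, poisson_neg_left, poisson_eps_left, neg_zero]
    · rw [h.map_eta j hj, poisson_eps_left]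
  · intro j _
    rw [h.map_x, poisson_x_left]
  · intro i j
    rw [h.map_q, h.map_q, poisson_q_q]
  · intro i j
    rcases eq_or_ne i m with rfl | hi <;> rcases eq_or_ne j i with rfl | hj
    · exact poisson_self _
    · simp only [h.map_p_self, h.map_p j hj, poisson_sub_left, poisson_div_left, poisson_p_p,
        poisson_q_p, poisson_eps_left, if_neg hj.symm]
      ring
    · exact poisson_self _
    · rcases eq_or_ne j m with rfl | hj'
      · simp only [h.map_p_self, h.map_p i hi, poisson_sub_right, poisson_div_right, poisson_p_p,
          poisson_p_q, poisson_eps_right, if_neg hi]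
        ring
      · rw [h.map_p i hi, h.map_p j hj', poisson_p_p]
  · intro i j
    rw [h.map_q]
    rcases eq_or_ne i m with rfl | hi
    · simp only [h.map_p_self, poisson_sub_left, poisson_div_left, poisson_q_q, poisson_p_q,
        poisson_eps_left]
      ring
    · rw [h.map_p i hi, poisson_p_q]

end

/-! ### The prescribed images -/

theorem two_mod (n : ℕ) : 2 % (n + 3) = 2 := Nat.mod_eq_of_lt (by omega)

theorem addNat_ne_zero (j : Fin n) : j.addNat 3 ≠ (0 : Fin (n + 3)) :=
  Fin.ne_of_val_ne (by simp only [Fin.val_addNat, Fin.val_zero]; omega)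

theorem addNat_ne_one (j : Fin n) : j.addNat 3 ≠ (1 : Fin (n + 3)) :=
  Fin.ne_of_val_ne (by simp only [Fin.val_addNat, Fin.val_one]; omega)

theorem addNat_ne_two (j : Fin n) : j.addNat 3 ≠ (2 : Fin (n + 3)) :=
  Fin.ne_of_val_ne (by simp only [Fin.val_addNat, Fin.coe_ofNat_eq_mod, two_mod]; omega)

theorem two_ne_zero_fin : (2 : Fin (n + 3)) ≠ 0 :=
  Fin.ne_of_val_ne (by rw [Fin.val_zero, Fin.coe_ofNat_eq_mod, two_mod]; decide)

theorem two_ne_one_fin : (2 : Fin (n + 3)) ≠ 1 :=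
  Fin.ne_of_val_ne (by rw [Fin.val_one, Fin.coe_ofNat_eq_mod, two_mod]; decide)

section

variable [NeZero n] {s : RatField n → RatField n} {k : Fin (n + 4)}

theorem img_eps_of_pos (h0 : (k : ℕ) ≠ 0) (h : (k : ℕ) ≤ n + 2) (j : Fin (n + 3)) :
    img k (.eps j) = ε (Equiv.swap ⟨k - 1, by omega⟩ ⟨k, by omega⟩ j) := by
  simp only [img, imgEps, dif_neg h0, dif_pos h]

theorem isS0_of_img (hk : (k : ℕ) = 0) (h : ∀ v, s (gen v) = img k v) : IsS0 s := by
  have hg : ∀ j, imgQ k j = p j * (q j * p j - η j) / (Q₁ n * (Q₁ n + ε 2)) := by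
    intro j
    simp [imgQ, hk]
  constructor <;> intros <;> rw [h]
  · simp [img, imgEps, hk]
  · simp [img, imgEps, hk]
  · simp [img, imgEps, hk, two_ne_zero_fin, two_ne_one_fin]
  · simp [img, imgEps, hk, addNat_ne_zero, addNat_ne_one]
  · exact hg _
  · rename_i j
    have h1 := Q₁_ne_zero (n := n)
    have h2 := Q₁_add_ne_zero (n := n)
    have h3 := gen_ne_zero (Var.p j)
    have h4 := mul_sub_eta_ne_zero j
    -- The quotient defining `imgP` cancels the factor qp - η against `imgQ`, leaving the shorter
    -- formula in `IsS0`.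
    have h5 : η j - q j * p j = -(q j * p j - η j) := by ring
    simp only [img, imgP, if_pos hk, hg]
    rw [h5]
    generalize q j * p j - η j = c at *
    field_simp
  · simp [img, imgX, hk]

theorem isS1_of_img (hk : (k : ℕ) = 1) (h : ∀ v, s (gen v) = img k v) : IsS1 s := by
  have e : ∀ j, img k (.eps j) = ε (Equiv.swap 0 1 j) := by
    intro j
    rw [img_eps_of_pos (by omega) (by omega)]
    congr 3 <;> simp [hk]
  constructor <;> intros <;> rw [h]
  · rw [e, Equiv.swap_apply_left]
  · rw [e, Equiv.swap_apply_right]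
  · rw [e, Equiv.swap_apply_of_ne_of_ne two_ne_zero_fin two_ne_one_fin]
  · rw [e, Equiv.swap_apply_of_ne_of_ne (addNat_ne_zero _) (addNat_ne_one _)]
  · simp [img, imgQ, hk]
  · simp [img, imgP, hk]
  · simp [img, imgX, hk]

theorem isS2_of_img (hk : (k : ℕ) = 2) (h : ∀ v, s (gen v) = img k v) : IsS2 s := by
  have e : ∀ j, img k (.eps j) = ε (Equiv.swap 1 2 j) := by
    intro j
    rw [img_eps_of_pos (by omega) (by omega)]
    congr 3 <;> simp [Fin.ext_iff, hk, two_mod]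
  constructor <;> intros <;> rw [h]
  · rw [e, Equiv.swap_apply_of_ne_of_ne zero_ne_one two_ne_zero_fin.symm]
  · rw [e, Equiv.swap_apply_left]
  · rw [e, Equiv.swap_apply_right]
  · rw [e, Equiv.swap_apply_of_ne_of_ne (addNat_ne_one _) (addNat_ne_two _)]
  · simp [img, imgQ, hk]
  · simp [img, imgP, hk]
  · simp [img, imgX, hk]

theorem isS3_of_img (hk : (k : ℕ) = 3) (h : ∀ v, s (gen v) = img k v) : IsS3 s := by
  have hn : 0 < n := NeZero.pos n
  have e : ∀ j, img k (.eps j) = ε (Equiv.swap 2 ((0 : Fin n).addNat 3) j) := by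
    intro j
    rw [img_eps_of_pos (by omega) (by omega)]
    congr 3 <;> simp [Fin.ext_iff, hk, two_mod]
  constructor
  · rw [h, e, Equiv.swap_apply_of_ne_of_ne two_ne_zero_fin.symm (addNat_ne_zero _).symm]
  · rw [h, e, Equiv.swap_apply_of_ne_of_ne two_ne_one_fin.symm (addNat_ne_one _).symm]
  · rw [h, e, Equiv.swap_apply_left]
  · rw [h, e, Equiv.swap_apply_right]
  · intro j hj
    have hj' : j.addNat 3 ≠ (0 : Fin n).addNat 3 := fun e => hj (Fin.ext (by
      have := congrArg Fin.val e
      simp only [Fin.val_addNat] at this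
      omega))
    rw [h, e, Equiv.swap_apply_of_ne_of_ne (addNat_ne_two _) hj']
  · simp [h, img, imgQ, hk]
  · intro j hj
    simp [h, img, imgQ, hk, hj]
  · simp [h, img, imgP, hk]
  · intro j hj
    simp [h, img, imgP, hk, hj]
  · simp [h, img, imgX, hk]
  · intro j hj
    simp [h, img, imgX, hk, hj]

theorem isPerm_of_img (hk : 4 ≤ (k : ℕ)) (hk' : (k : ℕ) ≤ n + 2)
    (h : ∀ v, s (gen v) = img k v) : IsPerm (adjSwap (n := n) k hk hk') s := by
  have h0 : (k : ℕ) ≠ 0 := by omega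
  have h1 : (k : ℕ) ≠ 1 := by omega
  have h2 : (k : ℕ) ≠ 2 := by omega
  have h3 : (k : ℕ) ≠ 3 := by omega
  constructor <;> intros <;> rw [h]
  · rw [img_eps_of_pos h0 hk', Equiv.swap_apply_of_ne_of_ne] <;> simp [Fin.ext_iff] <;> omega
  · rw [img_eps_of_pos h0 hk', Equiv.swap_apply_of_ne_of_ne] <;> simp [Fin.ext_iff] <;> omega
  · rw [img_eps_of_pos h0 hk', Equiv.swap_apply_of_ne_of_ne] <;> simp [Fin.ext_iff, two_mod] <;> omega
  · rename_i j
    rw [img_eps_of_pos h0 hk']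
    congr 1
    -- The positions `k - 1`, `k` among the parameters are `k - 4`, `k - 3` shifted by 3.
    simp only [adjSwap, Equiv.swap_apply_def, Fin.ext_iff, Fin.val_addNat]
    split_ifs <;> simp <;> omega
  · simp [img, imgQ, h0, h1, h2, h3, hk, hk']
  · simp [img, imgP, h0, h1, h2, h3, hk, hk']
  · simp [img, imgX, h0, h1, h2, h3, hk, hk']

theorem isSignChange_of_img (hk : (k : ℕ) = n + 3) (h : ∀ v, s (gen v) = img k v) {m : Fin n}
    (hm : (m : ℕ) + 1 = n) : IsSignChange m s := by
  have h0 : (k : ℕ) ≠ 0 := by omega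
  have h1 : (k : ℕ) ≠ 1 := by omega
  have h2 : (k : ℕ) ≠ 2 := by omega
  have h3 : (k : ℕ) ≠ 3 := by omega
  have h4 : ¬ (k : ℕ) ≤ n + 2 := by omega
  have hn : n ≠ 0 := NeZero.ne n
  have hj : ∀ j : Fin n, j ≠ m → (j : ℕ) + 1 ≠ n := fun j hj e => hj (Fin.ext (by omega))
  constructor
  · simp [h, img, imgEps, h0, h4]
  · simp [h, img, imgEps, h0, h4]
  -- `ε 2` would be the last parameter only for `n = 0`.
  · simp [h, img, imgEps, h0, h4, two_mod, hn]
  · rw [h]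
    simp only [img, imgEps, dif_neg h0, dif_neg h4]
    rw [if_pos (by simp; omega)]
  · intro j hjm
    have := hj j hjm
    rw [h]
    simp only [img, imgEps, dif_neg h0, dif_neg h4]
    rw [if_neg (by simp; omega)]
  · intro j
    simp [h, img, imgQ, h0, h1, h2, h3, h4]
  · simp [h, img, imgP, h0, h1, h2, h3, h4, hm]
  · intro j hjm
    simp [h, img, imgP, h0, h1, h2, h3, h4, hj j hjm]
  · intro j
    simp [h, img, imgX, h0, h1, h2, h3, h4]

end

/-! ### The variables as rational functions of their images -/

section

variable {s : RatField n → RatField n} {K : IntermediateField ℂ (RatField n)}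

theorem half_mem : (1 / 2 : RatField n) ∈ K :=
  div_mem (one_mem K) (ofNat_mem K 2)

/-- The products q_j p_j are recovered from η_j - s(q_j)s(p_j); they give `Q₁`, then p_j from
s(p_j), then q_j by division. -/
theorem IsS0.gen_mem (h : IsS0 s) (hK : ∀ v, s (gen v) ∈ K) (v : Var n) : gen v ∈ K := by
  have h0 : ε 0 ∈ K := by
    have := sub_mem (one_mem K) (hK (.eps 1))
    rwa [h.map_eps1, sub_sub_cancel] at this
  have h1 : ε 1 ∈ K := by
    have := sub_mem (one_mem K) (hK (.eps 0))
    rwa [h.map_eps0, sub_sub_cancel] at this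
  have h2 : ε 2 ∈ K := by
    have := hK (.eps 2)
    rwa [h.map_eps2] at this
  have hη : ∀ j : Fin n, η j ∈ K := fun j => by
    have := hK (.eps (j.addNat 3))
    rwa [h.map_eta] at this
  have hqp : ∀ j : Fin n, q j * p j ∈ K := fun j => by
    have := sub_mem (hη j) (mul_mem (hK (.q j)) (hK (.p j)))
    rwa [h.map_q_mul_map_p, sub_sub_cancel] at this
  have hQ₁ : Q₁ n ∈ K := by
    rw [Q₁_eq]
    exact add_mem (sum_mem fun j _ => hqp j) (mul_mem half_mem (sub_mem (sub_mem (sub_mem (sub_mem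
      (one_mem K) h0) h1) h2) (sum_mem fun j _ => hη j)))
  have hp : ∀ j : Fin n, p j ∈ K := fun j => by
    have := div_mem (mul_mem hQ₁ (add_mem hQ₁ h2)) (neg_mem (hK (.p j)))
    rwa [h.map_p, neg_neg, div_div_cancel₀ (mul_ne_zero Q₁_ne_zero Q₁_add_ne_zero)] at this
  refine gen_induction (P := fun f => f ∈ K) h0 h1 h2 hη (fun j => ?_) hp (fun j => ?_) v
  · have := div_mem (hqp j) (hp j)
    rwa [mul_div_cancel_right₀ _ (gen_ne_zero _)] at this
  · have := inv_mem (hK (.x j))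
    rwa [h.map_x, one_div, inv_inv] at this

theorem IsS1.gen_mem (h : IsS1 s) (hK : ∀ v, s (gen v) ∈ K) (v : Var n) : gen v ∈ K := by
  have hx : ∀ j : Fin n, x j ∈ K := fun j => by
    have := inv_mem (hK (.x j))
    rwa [h.map_x, one_div, inv_inv] at this
  refine gen_induction (P := fun f => f ∈ K) ?_ ?_ ?_ (fun j => ?_) (fun j => ?_) (fun j => ?_)
    hx v
  · rw [← h.map_eps1]; exact hK _
  · rw [← h.map_eps0]; exact hK _
  · rw [← h.map_eps2]; exact hK _
  · rw [← h.map_eta]; exact hK _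
  · have := mul_mem (hK (.q j)) (hx j)
    rwa [h.map_q, div_mul_cancel₀ _ (gen_ne_zero _)] at this
  · have := div_mem (hK (.p j)) (hx j)
    rwa [h.map_p, mul_div_cancel_left₀ _ (gen_ne_zero _)] at this

/-- `Q₂` is the inverse of ∑ s(q_j) - 1, which yields q_j and p_j - Q₁. Putting p_j - Q₁ for p_j in
the expression of `Q₁` gives -Q₁Q₂, which releases `Q₁` itself. -/
theorem IsS2.gen_mem (h : IsS2 s) (hK : ∀ v, s (gen v) ∈ K) (v : Var n) : gen v ∈ K := by
  have hQ₂0 := Q₂_ne_zero (n := n)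
  have h0 : ε 0 ∈ K := by rw [← h.map_eps0]; exact hK _
  have h1 : ε 1 ∈ K := by rw [← h.map_eps2]; exact hK _
  have h2 : ε 2 ∈ K := by rw [← h.map_eps1]; exact hK _
  have hη : ∀ j : Fin n, η j ∈ K := fun j => by rw [← h.map_eta]; exact hK _
  have hQ₂ : Q₂ n ∈ K := by
    have e : ∑ j, q j = Q₂ n + 1 := by rw [Q₂]; ring
    have := inv_mem (sub_mem (sum_mem fun j (_ : j ∈ Finset.univ) => hK (.q j)) (one_mem K))
    have e' : ∑ j, s (q j) - 1 = (Q₂ n)⁻¹ := by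
      simp only [h.map_q, ← Finset.sum_div, e]
      field_simp
      ring
    rwa [e', inv_inv] at this
  have hq : ∀ j : Fin n, q j ∈ K := fun j => by
    have := mul_mem (hK (.q j)) hQ₂
    rwa [h.map_q, div_mul_cancel₀ _ hQ₂0] at this
  have hpQ : ∀ j : Fin n, p j - Q₁ n ∈ K := fun j => by
    have := div_mem (hK (.p j)) hQ₂
    rwa [h.map_p, mul_div_cancel_right₀ _ hQ₂0] at this
  have hQ₁ : Q₁ n ∈ K := by
    have := add_mem (sum_mem fun j (_ : j ∈ Finset.univ) => mul_mem (hq j) (hpQ j))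
      (mul_mem half_mem (sub_mem (sub_mem (sub_mem (sub_mem (one_mem K) h0) h1) h2)
        (sum_mem fun j (_ : j ∈ Finset.univ) => hη j)))
    have e : ∑ j, q j * (p j - Q₁ n) + 1 / 2 * (1 - ε 0 - ε 1 - ε 2 - ∑ j : Fin n, η j) =
        -(Q₁ n * Q₂ n) := by
      have e' : Q₁ n * Q₂ n = (∑ j, q j) * Q₁ n - Q₁ n := by rw [Q₂]; ring
      simp only [mul_sub, Finset.sum_sub_distrib, ← Finset.sum_mul, e']
      linear_combination -Q₁_eq (n := n)
    rw [e] at this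
    have := div_mem (neg_mem this) hQ₂
    rwa [neg_neg, mul_div_cancel_right₀ _ hQ₂0] at this
  refine gen_induction (P := fun f => f ∈ K) h0 h1 h2 hη hq (fun j => ?_) (fun j => ?_) v
  · have := add_mem (hpQ j) hQ₁
    rwa [sub_add_cancel] at this
  · have := div_mem (hK (.x j)) (sub_mem (hK (.x j)) (one_mem K))
    have e : x j / (x j - 1) - 1 = 1 / (x j - 1) := by
      have := x_sub_one_ne_zero j
      field_simp
      ring
    rwa [h.map_x, e, div_div_div_cancel_right₀ (x_sub_one_ne_zero j), div_one] at this

theorem IsS3.gen_mem [NeZero n] (h : IsS3 s) (hK : ∀ v, s (gen v) ∈ K) (v : Var n) :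
    gen v ∈ K := by
  have hq0 := gen_ne_zero (Var.q (0 : Fin n))
  have h0 : ε 0 ∈ K := by rw [← h.map_eps0]; exact hK _
  have h1 : ε 1 ∈ K := by rw [← h.map_eps1]; exact hK _
  have h2 : ε 2 ∈ K := by rw [← h.map_eta_zero]; exact hK _
  have hη : ∀ j : Fin n, η j ∈ K := fun j => by
    rcases eq_or_ne j 0 with rfl | hj
    · rw [← h.map_eps2]; exact hK _
    · rw [← h.map_eta j hj]; exact hK _
  have hq0K : q 0 ∈ K := by
    have := inv_mem (hK (.q 0))
    rwa [h.map_q_zero, one_div, inv_inv] at this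
  have hq : ∀ j : Fin n, q j ∈ K := fun j => by
    rcases eq_or_ne j 0 with rfl | hj
    · exact hq0K
    · have := mul_mem (neg_mem (hK (.q j))) hq0K
      rwa [h.map_q j hj, neg_neg, div_mul_cancel₀ _ hq0] at this
  have hx0K : x 0 ∈ K := by
    have := inv_mem (hK (.x 0))
    rwa [h.map_x_zero, one_div, inv_inv] at this
  have hx : ∀ j : Fin n, x j ∈ K := fun j => by
    rcases eq_or_ne j 0 with rfl | hj
    · exact hx0K
    · have := mul_mem (hK (.x j)) hx0K
      rwa [h.map_x j hj, div_mul_cancel₀ _ (gen_ne_zero _)] at this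
  have hQ₁ : Q₁ n ∈ K := by
    have := div_mem (neg_mem (hK (.p 0))) hq0K
    rwa [h.map_p_zero, neg_neg, mul_div_cancel_left₀ _ hq0] at this
  have hp : ∀ j : Fin n, j ≠ 0 → p j ∈ K := fun j hj => by
    have := div_mem (neg_mem (hK (.p j))) hq0K
    rwa [h.map_p j hj, neg_neg, mul_div_cancel_left₀ _ hq0] at this
  -- s(p₀) yields only `Q₁`; p₀ is then found by solving the expression of `Q₁` for its term q₀p₀.
  have hp0 : p 0 ∈ K := by
    have := div_mem (sub_mem (sub_mem hQ₁ (sum_mem fun j (hj : j ∈ Finset.univ.erase (0 : Fin n)) =>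
      mul_mem (hq j) (hp j (Finset.ne_of_mem_erase hj)))) (mul_mem half_mem (sub_mem (sub_mem
        (sub_mem (sub_mem (one_mem K) h0) h1) h2)
          (sum_mem fun j (_ : j ∈ Finset.univ) => hη j)))) hq0K
    have e := Q₁_eq (n := n)
    rw [sum_eq_zero_add] at e
    rwa [e, add_sub_right_comm, add_sub_cancel_right, add_sub_cancel_right,
      mul_div_cancel_left₀ _ hq0] at this
  refine gen_induction (P := fun f => f ∈ K) h0 h1 h2 hη hq (fun j => ?_) hx v
  rcases eq_or_ne j 0 with rfl | hj
  · exact hp0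
  · exact hp j hj

theorem IsPerm.gen_mem {σ : Equiv.Perm (Fin n)} (h : IsPerm σ s) (hK : ∀ v, s (gen v) ∈ K)
    (v : Var n) : gen v ∈ K := by
  refine gen_induction (P := fun f => f ∈ K) ?_ ?_ ?_ (fun j => ?_) (fun j => ?_) (fun j => ?_)
    (fun j => ?_) v
  · rw [← h.map_eps0]; exact hK _
  · rw [← h.map_eps1]; exact hK _
  · rw [← h.map_eps2]; exact hK _
  · rw [← σ.apply_symm_apply j, ← h.map_eta]; exact hK _
  · rw [← σ.apply_symm_apply j, ← h.map_q]; exact hK _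
  · rw [← σ.apply_symm_apply j, ← h.map_p]; exact hK _
  · rw [← σ.apply_symm_apply j, ← h.map_x]; exact hK _

theorem IsSignChange.gen_mem {m : Fin n} (h : IsSignChange m s) (hK : ∀ v, s (gen v) ∈ K)
    (v : Var n) : gen v ∈ K := by
  have hη : ∀ j : Fin n, η j ∈ K := fun j => by
    rcases eq_or_ne j m with rfl | hj
    · have := neg_mem (hK (.eps (j.addNat 3)))
      rwa [h.map_eta_self, neg_neg] at this
    · rw [← h.map_eta j hj]; exact hK _
  have hq : ∀ j : Fin n, q j ∈ K := fun j => by rw [← h.map_q]; exact hK _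
  refine gen_induction (P := fun f => f ∈ K) ?_ ?_ ?_ hη hq (fun j => ?_) (fun j => ?_) v
  · rw [← h.map_eps0]; exact hK _
  · rw [← h.map_eps1]; exact hK _
  · rw [← h.map_eps2]; exact hK _
  · rcases eq_or_ne j m with rfl | hj
    · have := add_mem (hK (.p j)) (div_mem (hη j) (hq j))
      rwa [h.map_p_self, sub_add_cancel] at this
    · rw [← h.map_p j hj]; exact hK _
  · rw [← h.map_x]; exact hK _

end

/-! ### Existence, uniqueness and relations -/

theorem adjSwap_comm {k l : ℕ} (hk : 4 ≤ k) (hk' : k ≤ n + 2) (hl : 4 ≤ l) (hl' : l ≤ n + 2)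
    (h : k + 1 < l) : adjSwap (n := n) k hk hk' * adjSwap l hl hl' =
      adjSwap l hl hl' * adjSwap k hk hk' := by
  have : (adjSwap (n := n) k hk hk').Disjoint (adjSwap l hl hl') := by
    intro j
    by_cases h1 : (j : ℕ) = k - 4 ∨ (j : ℕ) = k - 3
    · right
      refine Equiv.swap_apply_of_ne_of_ne ?_ ?_ <;> refine Fin.ne_of_val_ne ?_ <;> simp only <;>
        omega
    · left
      refine Equiv.swap_apply_of_ne_of_ne ?_ ?_ <;> refine Fin.ne_of_val_ne ?_ <;> simp only <;>
        omega
  exact this.commute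

theorem adjSwap_braid {k : ℕ} (hk : 4 ≤ k) (hk' : k ≤ n + 2) (hl : 4 ≤ k + 1)
    (hl' : k + 1 ≤ n + 2) :
    adjSwap (n := n) k hk hk' * adjSwap (k + 1) hl hl' * adjSwap k hk hk' =
      adjSwap (k + 1) hl hl' * adjSwap k hk hk' * adjSwap (k + 1) hl hl' := by
  have e : (⟨k + 1 - 4, by omega⟩ : Fin n) = ⟨k - 3, by omega⟩ := Fin.ext (by simp only; omega)
  unfold adjSwap
  rw [e]
  have h1 : (⟨k - 4, by omega⟩ : Fin n) ≠ ⟨k - 3, by omega⟩ :=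
    Fin.ne_of_val_ne (by simp only; omega)
  have h2 : (⟨k - 3, by omega⟩ : Fin n) ≠ ⟨k + 1 - 3, by omega⟩ :=
    Fin.ne_of_val_ne (by simp only; omega)
  have h3 : (⟨k - 4, by omega⟩ : Fin n) ≠ ⟨k + 1 - 3, by omega⟩ :=
    Fin.ne_of_val_ne (by simp only; omega)
  generalize (⟨k - 4, by omega⟩ : Fin n) = a at *
  generalize (⟨k - 3, by omega⟩ : Fin n) = b at *
  generalize (⟨k + 1 - 3, by omega⟩ : Fin n) = c at *
  -- Both sides are the transposition of `a` and `c`.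
  rw [Equiv.swap_mul_swap_mul_swap h1 h3, Equiv.swap_comm a b, Equiv.swap_comm b c,
    Equiv.swap_mul_swap_mul_swap h2.symm h3.symm, Equiv.swap_comm]

section

variable [NeZero n]

/-- The last index in `Fin n`. -/
def lastIdx (n : ℕ) [NeZero n] : Fin n := ⟨n - 1, Nat.sub_lt (NeZero.pos n) one_pos⟩

theorem lastIdx_add_one : (lastIdx n : ℕ) + 1 = n := Nat.sub_add_cancel (NeZero.pos n)

theorem img_cases {P : Prop} {s : RatField n → RatField n} {k : Fin (n + 4)}
    (h : ∀ v, s (gen v) = img k v) (h0 : IsS0 s → P) (h1 : IsS1 s → P) (h2 : IsS2 s → P)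
    (h3 : IsS3 s → P) (hp : ∀ hk : 4 ≤ (k : ℕ), ∀ hk' : (k : ℕ) ≤ n + 2,
      IsPerm (adjSwap (n := n) k hk hk') s → P) (hl : IsSignChange (lastIdx n) s → P) : P := by
  have hk := k.2
  have : (k : ℕ) = 0 ∨ (k : ℕ) = 1 ∨ (k : ℕ) = 2 ∨ (k : ℕ) = 3 ∨
      (4 ≤ (k : ℕ) ∧ (k : ℕ) ≤ n + 2) ∨ (k : ℕ) = n + 3 := by omega
  rcases this with hk | hk | hk | hk | ⟨hk, hk'⟩ | hk
  · exact h0 (isS0_of_img hk h)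
  · exact h1 (isS1_of_img hk h)
  · exact h2 (isS2_of_img hk h)
  · exact h3 (isS3_of_img hk h)
  · exact hp hk hk' (isPerm_of_img hk hk' h)
  · exact hl (isSignChange_of_img hk h lastIdx_add_one)

/-- No automorphism is available yet, so the six descriptions are applied to a bare function
extending `img k` along `gen`; its value 0 elsewhere plays no role. This is why they are stated for
functions. -/
theorem gen_mem_adjoin_img (k : Fin (n + 4)) (v : Var n) :
    gen v ∈ IntermediateField.adjoin ℂ (Set.range (img (n := n) k)) := by
  have hinj : Function.Injective (gen : Var n → RatField n) := algebraicIndependent_gen.injective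
  have hs : ∀ v, Function.extend gen (img k) 0 (gen v) = img k v := fun v => hinj.extend_apply _ _ v
  have hK : ∀ v, Function.extend gen (img k) 0 (gen v) ∈
      IntermediateField.adjoin ℂ (Set.range (img (n := n) k)) := fun v => by
    rw [hs]
    exact IntermediateField.subset_adjoin _ _ ⟨v, rfl⟩
  exact img_cases hs (fun h => h.gen_mem hK v) (fun h => h.gen_mem hK v) (fun h => h.gen_mem hK v)
    (fun h => h.gen_mem hK v) (fun _ _ h => h.gen_mem hK v) (fun h => h.gen_mem hK v)

theorem existsUnique_isAction :
    ∃! s : Fin (n + 4) → (RatField n ≃ₐ[ℂ] RatField n), IsAction s := by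
  choose s hs using fun k => exists_algEquiv (img (n := n) k) (gen_mem_adjoin_img k)
  refine ⟨s, hs, fun t ht => funext fun k => algEquiv_ext fun v => ?_⟩
  rw [ht, hs]

variable {s : Fin (n + 4) → (RatField n ≃ₐ[ℂ] RatField n)}

theorem IsAction.isCanonical (h : IsAction s) (k : Fin (n + 4)) : IsCanonical (s k) :=
  img_cases (h k) IsS0.isCanonical IsS1.isCanonical IsS2.isCanonical IsS3.isCanonical
    (fun _ _ => IsPerm.isCanonical) IsSignChange.isCanonical

theorem IsAction.mul_self (h : IsAction s) (k : Fin (n + 4)) : s k * s k = 1 :=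
  img_cases (h k) IsS0.mul_self IsS1.mul_self IsS2.mul_self IsS3.mul_self
    (fun _ _ hp => (hp.mul hp).eq (by rw [adjSwap, Equiv.swap_mul_self]; exact isPerm_one))
    IsSignChange.mul_self

theorem IsAction.comm_of_lt (h : IsAction s) {k l : Fin (n + 4)} (hkl : (k : ℕ) + 1 < l)
    (h02 : ¬((k : ℕ) = 0 ∧ (l : ℕ) = 2)) : s k * s l = s l * s k := by
  have hl := l.2
  have hlast := lastIdx_add_one (n := n)
  have hsl : (l : ℕ) = n + 3 → IsSignChange (lastIdx n) (s l) := fun e =>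
    isSignChange_of_img e (h l) hlast
  -- The gap forces `l ≥ 2`, and `l = 2` would force `k = 0`, the excluded pair.
  have hl' : (l : ℕ) = 3 ∨ (4 ≤ (l : ℕ) ∧ (l : ℕ) ≤ n + 2) ∨ (l : ℕ) = n + 3 := by omega
  have hk' : (k : ℕ) = 0 ∨ (k : ℕ) = 1 ∨ (k : ℕ) = 2 ∨ (k : ℕ) = 3 ∨
      (4 ≤ (k : ℕ) ∧ (k : ℕ) ≤ n + 2) := by omega
  rcases hk' with hk | hk | hk | hk | ⟨hk, hk'⟩
  · have hk := isS0_of_img hk (h k)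
    rcases hl' with hl | ⟨hl, hl'⟩ | hl
    · exact hk.comm_isS3 (isS3_of_img hl (h l))
    · exact hk.comm_isPerm (isPerm_of_img hl hl' (h l))
    · exact hk.comm_isSignChange (hsl hl)
  · have hk := isS1_of_img hk (h k)
    rcases hl' with hl | ⟨hl, hl'⟩ | hl
    · exact hk.comm_isS3 (isS3_of_img hl (h l))
    · exact hk.comm_isPerm (isPerm_of_img hl hl' (h l))
    · exact hk.comm_isSignChange (hsl hl)
  · rcases hl' with hl | ⟨hl, hl'⟩ | hl
    · omega
    · exact (isS2_of_img hk (h k)).comm_isPerm (isPerm_of_img hl hl' (h l))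
    · exact (isS2_of_img hk (h k)).comm_isSignChange (hsl hl)
  · rcases hl' with hl | ⟨hl, hl'⟩ | hl
    · omega
    · refine (isS3_of_img hk (h k)).comm_isPerm ?_ (isPerm_of_img hl hl' (h l))
      refine Equiv.swap_apply_of_ne_of_ne ?_ ?_ <;> refine Fin.ne_of_val_ne ?_ <;>
        simp only [Fin.val_zero] <;> omega
    · refine (isS3_of_img hk (h k)).comm_isSignChange (Fin.ne_of_val_ne ?_) (hsl hl)
      simp only [Fin.val_zero]
      omega
  · rcases hl' with hl | ⟨hl, hl'⟩ | hl
    · omega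
    · have h1 := isPerm_of_img hk hk' (h k)
      have h2 := isPerm_of_img hl hl' (h l)
      refine (h1.mul h2).eq ?_
      rw [adjSwap_comm hk hk' hl hl' hkl]
      exact h2.mul h1
    · refine (isPerm_of_img hk hk' (h k)).comm_isSignChange ?_ (hsl hl)
      refine Equiv.swap_apply_of_ne_of_ne ?_ ?_ <;> refine Fin.ne_of_val_ne ?_ <;>
        simp only <;> omega

theorem IsAction.braid (h : IsAction s) {k l : Fin (n + 4)} (hk : 1 ≤ (k : ℕ))
    (hk' : (k : ℕ) ≤ n + 1) (hl : (l : ℕ) = k + 1) : s k * s l * s k = s l * s k * s l := by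
  have hcases : (k : ℕ) = 1 ∨ (k : ℕ) = 2 ∨ (k : ℕ) = 3 ∨ 4 ≤ (k : ℕ) := by omega
  rcases hcases with hk1 | hk1 | hk1 | hk1
  · exact (isS1_of_img hk1 (h k)).braid_isS2 (isS2_of_img (by omega) (h l))
  · exact (isS2_of_img hk1 (h k)).braid_isS3 (isS3_of_img (by omega) (h l))
  · have hp := isPerm_of_img (by omega) (by omega) (h l)
    refine (isS3_of_img hk1 (h k)).braid_isPerm (m := ⟨1, by omega⟩) ?_ ?_
    · exact Fin.ne_of_val_ne (by simp)
    · have e : adjSwap (n := n) l (by omega) (by omega) = Equiv.swap 0 ⟨1, by omega⟩ := by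
        unfold adjSwap
        congr 1 <;> simp [hl, hk1]
      rwa [e] at hp
  · have h1 := isPerm_of_img hk1 (by omega) (h k)
    have h2 := isPerm_of_img (by omega) (by omega) (h l)
    refine ((h1.mul h2).mul h1).eq ?_
    have e := adjSwap_braid (n := n) hk1 (by omega) (by omega) (by omega)
    simp only [hl] at h2 ⊢
    rw [e]
    exact (h2.mul h1).mul h2

theorem IsAction.mul_pow_four (h : IsAction s) {k l : Fin (n + 4)} (hk : (k : ℕ) = n + 2)
    (hl : (l : ℕ) = n + 3) : (s k * s l) ^ 4 = 1 := by
  have hlast := lastIdx_add_one (n := n)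
  have hsl : IsSignChange (lastIdx n) (s l) := isSignChange_of_img hl (h l) hlast
  refine mul_pow_four_eq_one_of_comm (h.mul_self k) (h.mul_self l) ?_
  -- For `n = 1` the penultimate generator is s₃, and conjugation moves the sign change to `ε 2`;
  -- otherwise it swaps the last two indices and moves the sign change to the index before the last.
  rcases eq_or_ne n 1 with hn | hn
  · have e : lastIdx n = 0 := Fin.ext (by simp only [Fin.val_zero]; omega)
    rw [e] at hsl
    have h3 := isS3_of_img (by omega) (h k)
    exact (h3.conj_isSignChange hsl).comm_isSignChange hsl
  · have hn0 := NeZero.ne n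
    have hp := isPerm_of_img (by omega) (by omega) (h k)
    refine IsSignChange.comm ?_ (hp.conj_isSignChange (Equiv.swap_apply_self _ _) hsl) hsl
    have e : (⟨k - 3, by omega⟩ : Fin n) = lastIdx n := Fin.ext (by simp only; omega)
    rw [← e, Equiv.swap_apply_right]
    exact Fin.ne_of_val_ne (by simp only; omega)

end

end

end Garnier

theorem mainTheorem1 (n : ℕ) [NeZero n] :
    (∃! s : Fin (n + 4) → (Garnier.RatField n ≃ₐ[ℂ] Garnier.RatField n), Garnier.IsAction s) ∧
    ∀ s : Fin (n + 4) → (Garnier.RatField n ≃ₐ[ℂ] Garnier.RatField n), Garnier.IsAction s →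
      (∀ k : Fin (n + 4), Garnier.IsCanonical (s k)) ∧
      (∀ k : Fin (n + 4), s k ^ 2 = 1) ∧
      (∀ k l : Fin (n + 4), ((k : ℕ) + 1 < l ∨ (l : ℕ) + 1 < k) →
        ¬((k : ℕ) = 0 ∧ (l : ℕ) = 2) → ¬((k : ℕ) = 2 ∧ (l : ℕ) = 0) →
          (s k * s l) ^ 2 = 1) ∧
      (∀ k l : Fin (n + 4), 1 ≤ (k : ℕ) → (k : ℕ) ≤ n + 1 → (l : ℕ) = (k : ℕ) + 1 →
        (s k * s l) ^ 3 = 1) ∧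
      (s 0 * s 1) ^ 2 = 1 ∧
      (s 0 * s 2) ^ 3 = 1 ∧
      (s ⟨n + 2, by omega⟩ * s ⟨n + 3, by omega⟩) ^ 4 = 1 := by
  refine ⟨Garnier.existsUnique_isAction, fun s h => ⟨h.isCanonical, fun k => ?_, ?_, ?_, ?_, ?_, ?_⟩⟩
  · rw [pow_two, h.mul_self]
  · intro k l hkl h1 h2
    refine Garnier.mul_sq_eq_one_of_comm (h.mul_self k) (h.mul_self l) ?_
    rcases hkl with hkl | hkl
    · exact h.comm_of_lt hkl h1
    · exact (h.comm_of_lt hkl fun e => h2 e.symm).symm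
  · intro k l hk hk' hl
    exact Garnier.mul_pow_three_eq_one_of_braid (h.mul_self k) (h.mul_self l) (h.braid hk hk' hl)
  · exact Garnier.mul_sq_eq_one_of_comm (h.mul_self 0) (h.mul_self 1)
      ((Garnier.isS0_of_img rfl (h 0)).comm_isS1 (Garnier.isS1_of_img (Fin.val_one _) (h 1)))
  · exact Garnier.mul_pow_three_eq_one_of_braid (h.mul_self 0) (h.mul_self 2)
      ((Garnier.isS0_of_img rfl (h 0)).braid_isS2
        (Garnier.isS2_of_img (k := 2) (Nat.mod_eq_of_lt (show 2 < n + 4 by omega)) (h 2)))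
  · exact h.mul_pow_four rfl rfl
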